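/- Let $\mathbb{D}=\{x\in\mathbb{R}^2:|x|<1\}$ with boundary circle $\Gamma=\partial\mathbb{D}$, arc length $\mathrm{d}\sigma$, and $H=L^2(\mathbb{D})\times L^2(\Gamma)$ (complex Hilbert space). Let $V=\{(u,w)\in H^1(\mathbb{D})\times H^1(\Gamma): u|_\Gamma=w\}$, and let $A$ be the unbounded operator on $H$ associated with the form $\int_{\mathbb{D}}\nabla u\cdot\overline{\nabla v}\,\mathrm{d}x+\int_\Gamma\nabla_\Gamma u\cdot\overline{\nabla_\Gamma v}\,\mathrm{d}\sigma$ on $V$: a vector $U\in V$ belongs to $\operatorname{dom}(A)$, with $AU=F\in H$, if the form at $(U,W)$ equals $\langle F,W\rangle_H$ for all $W\in V$. (Thus $Au=(-\Delta u,-\Delta_\Gamma u+\partial_\nu u)$.) Let $Be=(0,e)$ for $e\in L^2(\Gamma)$ and let $P(z)=A+zBB^*+z^2$, $z\in\mathbb{C}$, with $\operatorname{dom}(P(z))=\operatorname{dom}(A)$. A number $z$ is an eigenvalue of $P$ if $P(z)u=0$ for some nonzero $u\in\operatorname{dom}(A)$, which is then called an eigenvector. Let $J_0$ be the Bessel function of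 the first kind of order $0$, and put $\varphi_k=k\pi-\frac{\pi}{4}$. There exists a sequence $(\lambda_k)$ of complex numbers, defined for large $k$, with $$(i\lambda_k-\lambda_k^2)J_0(\lambda_k)+\lambda_kJ_0'(\lambda_k)=0\ \text{ for all large } k,\qquad \lambda_k=\varphi_k+\frac{1}{8\varphi_k}+\frac{\varphi_k}{1+\varphi_k^2}+\frac{i}{1+\varphi_k^2}+O\!\left(\frac1{k^3}\right),\quad k\to+\infty.$$ For every such sequence, writing $z_k=i\lambda_k$ and $\omega_k=\operatorname{Im}z_k$, the following hold. 1. $\omega_k\to+\infty$, and for all sufficiently large $k$ the number $z_k$ is an eigenvalue of $P$, with eigenvector the radial function $u(x)=J_0(\lambda_k|x|)$, that is, the pair formed by this function on $\mathbb{D}$ and its restriction to $\Gamma$. 2. For any sequence $(u_k)$ such that, for all large $k$, $u_k$ is an eigenvector associated with $z_k$ and $\|u_k\|_H=1$, $$\|P(i\omega_k)u_k\|_H=O(\omega_k^{-1}),\qquad k\to+\infty.$$ 3. Consequently a resolvent estimate $\|P(i\lambda)^{-1}\|_{\mathcal{L}(H)}=O(|\lambda|)$, $\lambda\to\pm\infty$,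 cannot be improved: there is $c>0$ such that, for all sufficiently large $k$, every bounded inverse $P(i\omega_k)^{-1}\in\mathcal{L}(H)$ of $P(i\omega_k)$ satisfies $\|P(i\omega_k)^{-1}\|_{\mathcal{L}(H)}\ge c\,\omega_k$. -/

import Mathlib

open MeasureTheory Filter Asymptotics Topology
open scoped ContDiff ComplexConjugate

noncomputable section

namespace WaveDisk

/-! The Euclidean plane is identified with `ℂ`; the coordinate directions are `1` and `Complex.I`. -/

/-- The open unit disk of the plane. -/
abbrev disk : Set ℂ := Metric.ball 0 1

/-- The surface measure (arc length) of the unit circle, seen as a measure on the plane. -/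
def arcLength : Measure ℂ :=
  Measure.map (fun θ : ℝ => Complex.exp (θ * Complex.I))
    (volume.restrict (Set.Ioc (-Real.pi) Real.pi))

/-- The complex space `L²` of the unit disk. -/
abbrev L2Disk := Lp ℂ 2 (volume.restrict disk)

/-- The complex space `L²` of the unit circle. -/
abbrev L2Circle := Lp ℂ 2 arcLength

/-- The Hilbert space `H = L²(disk) × L²(circle)`. -/
abbrev H := WithLp 2 (L2Disk × L2Circle)

/-- `g` is the weak partial derivative of `u` in the direction `e` on the open disk. -/
def IsWeakPartial (e : ℂ) (u g : L2Disk) : Prop :=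
  ∀ φ : ℂ → ℂ, ContDiff ℝ ∞ φ → HasCompactSupport φ → tsupport φ ⊆ disk →
    ∫ x in disk, u x * fderiv ℝ φ x e = - ∫ x in disk, g x * φ x

/-- The tangential derivative on the unit circle of a function defined on the plane: the derivative
along the unit tangent vector `i x` at `x`. -/
def tangentialDeriv (φ : ℂ → ℂ) (x : ℂ) : ℂ := fderiv ℝ φ x (Complex.I * x)

/-- `t` is the weak tangential derivative of `w` on the unit circle. Smooth functions on the circle
are the restrictions of smooth functions on the plane. -/
def IsWeakTangential (w t : L2Circle) : Prop :=
  ∀ φ : ℂ → ℂ, ContDiff ℝ ∞ φ →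
    ∫ x, w x * tangentialDeriv φ x ∂arcLength = - ∫ x, t x * φ x ∂arcLength

theorem memLp_disk {φ : ℂ → ℂ} (hφ : Continuous φ) : MemLp φ 2 (volume.restrict disk) := by
  obtain ⟨C, hC⟩ := (isCompact_closedBall (0 : ℂ) 1).exists_bound_of_continuousOn hφ.continuousOn
  have : IsFiniteMeasure ((volume : Measure ℂ).restrict disk) :=
    ⟨by simp⟩
  refine MemLp.of_bound hφ.aestronglyMeasurable C ?_
  filter_upwards [ae_restrict_mem Metric.isOpen_ball.measurableSet] with x hx
  exact hC x (Metric.ball_subset_closedBall hx)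

instance : IsFiniteMeasure arcLength := by
  unfold arcLength
  infer_instance

theorem ae_arcLength : ∀ᵐ x ∂arcLength, ‖x‖ = 1 := by
  unfold arcLength
  rw [ae_map_iff (by fun_prop) (measurableSet_eq_fun (by fun_prop) (by fun_prop))]
  simp

theorem memLp_circle {φ : ℂ → ℂ} (hφ : Continuous φ) : MemLp φ 2 arcLength := by
  obtain ⟨C, hC⟩ := (isCompact_closedBall (0 : ℂ) 1).exists_bound_of_continuousOn hφ.continuousOn
  refine MemLp.of_bound hφ.aestronglyMeasurable C ?_
  filter_upwards [ae_arcLength] with x hx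
  exact hC x (by simp [hx])

theorem integrable_disk (u : L2Disk) {φ : ℂ → ℂ} (hφ : Continuous φ) :
    Integrable (fun x => u x * φ x) (volume.restrict disk) :=
  (Lp.memLp u).integrable_mul (memLp_disk hφ)

theorem integrable_circle (u : L2Circle) {φ : ℂ → ℂ} (hφ : Continuous φ) :
    Integrable (fun x => u x * φ x) arcLength :=
  (Lp.memLp u).integrable_mul (memLp_circle hφ)

theorem integral_add_disk (u v : L2Disk) {φ : ℂ → ℂ} (hφ : Continuous φ) :
    ∫ x in disk, (u + v) x * φ x = (∫ x in disk, u x * φ x) + ∫ x in disk, v x * φ x := by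
  rw [← integral_add (integrable_disk u hφ) (integrable_disk v hφ)]
  refine integral_congr_ae ?_
  filter_upwards [Lp.coeFn_add u v] with x hx
  rw [hx, Pi.add_apply, add_mul]

theorem integral_smul_disk (c : ℂ) (u : L2Disk) (φ : ℂ → ℂ) :
    ∫ x in disk, (c • u) x * φ x = c * ∫ x in disk, u x * φ x := by
  rw [← integral_const_mul]
  refine integral_congr_ae ?_
  filter_upwards [Lp.coeFn_smul c u] with x hx
  rw [hx, Pi.smul_apply, smul_eq_mul, mul_assoc]

theorem integral_zero_disk (φ : ℂ → ℂ) : ∫ x in disk, (0 : L2Disk) x * φ x = 0 := by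
  simpa using integral_smul_disk 0 0 φ

theorem integral_add_circle (u v : L2Circle) {φ : ℂ → ℂ} (hφ : Continuous φ) :
    ∫ x, (u + v) x * φ x ∂arcLength
      = (∫ x, u x * φ x ∂arcLength) + ∫ x, v x * φ x ∂arcLength := by
  rw [← integral_add (integrable_circle u hφ) (integrable_circle v hφ)]
  refine integral_congr_ae ?_
  filter_upwards [Lp.coeFn_add u v] with x hx
  rw [hx, Pi.add_apply, add_mul]

theorem integral_smul_circle (c : ℂ) (u : L2Circle) (φ : ℂ → ℂ) :
    ∫ x, (c • u) x * φ x ∂arcLength = c * ∫ x, u x * φ x ∂arcLength := by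
  rw [← integral_const_mul]
  refine integral_congr_ae ?_
  filter_upwards [Lp.coeFn_smul c u] with x hx
  rw [hx, Pi.smul_apply, smul_eq_mul, mul_assoc]

theorem integral_zero_circle (φ : ℂ → ℂ) : ∫ x, (0 : L2Circle) x * φ x ∂arcLength = 0 := by
  simpa using integral_smul_circle 0 0 φ

theorem continuous_fderiv {φ : ℂ → ℂ} (hφ : ContDiff ℝ ∞ φ) (e : ℂ) :
    Continuous fun x => fderiv ℝ φ x e :=
  (hφ.continuous_fderiv (by simp)).clm_apply continuous_const

theorem continuous_tangentialDeriv {φ : ℂ → ℂ} (hφ : ContDiff ℝ ∞ φ) :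
    Continuous (tangentialDeriv φ) :=
  (hφ.continuous_fderiv (by simp)).clm_apply (by fun_prop)

/-- The data `(φ, ∂₁φ, ∂₂φ, φ restricted to the circle)` of the functions `φ` that are smooth up to
the boundary of the disk. -/
def smoothTraces : Submodule ℂ (L2Disk × L2Disk × L2Disk × L2Circle) where
  carrier := {d | ∃ φ : ℂ → ℂ, ContDiff ℝ ∞ φ ∧
    d.1 =ᵐ[volume.restrict disk] φ ∧
    d.2.1 =ᵐ[volume.restrict disk] (fun x => fderiv ℝ φ x 1) ∧
    d.2.2.1 =ᵐ[volume.restrict disk] (fun x => fderiv ℝ φ x Complex.I) ∧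
    d.2.2.2 =ᵐ[arcLength] φ}
  add_mem' := by
    rintro a b ⟨φ, hφ, h1, h2, h3, h4⟩ ⟨ψ, hψ, k1, k2, k3, k4⟩
    have hf : ∀ x, fderiv ℝ (φ + ψ) x = fderiv ℝ φ x + fderiv ℝ ψ x := fun x =>
      fderiv_add (hφ.differentiable (by simp) x) (hψ.differentiable (by simp) x)
    refine ⟨φ + ψ, hφ.add hψ, ?_, ?_, ?_, ?_⟩
    · exact (Lp.coeFn_add _ _).trans (h1.add k1)
    · refine (Lp.coeFn_add _ _).trans ((h2.add k2).trans (Eventually.of_forall fun x => ?_))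
      simp [hf]
    · refine (Lp.coeFn_add _ _).trans ((h3.add k3).trans (Eventually.of_forall fun x => ?_))
      simp [hf]
    · exact (Lp.coeFn_add _ _).trans (h4.add k4)
  zero_mem' := by
    refine ⟨0, contDiff_const, Lp.coeFn_zero _ _ _, ?_, ?_, Lp.coeFn_zero _ _ _⟩
    · refine (Lp.coeFn_zero _ _ _).trans (Eventually.of_forall fun x => ?_)
      simp
    · refine (Lp.coeFn_zero _ _ _).trans (Eventually.of_forall fun x => ?_)
      simp
  smul_mem' := by
    rintro c a ⟨φ, hφ, h1, h2, h3, h4⟩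
    have hf : ∀ x, fderiv ℝ (c • φ) x = c • fderiv ℝ φ x := fun x =>
      fderiv_const_smul (hφ.differentiable (by simp) x) c
    refine ⟨c • φ, hφ.const_smul c, ?_, ?_, ?_, ?_⟩
    · exact (Lp.coeFn_smul _ _).trans (h1.const_smul c)
    · refine (Lp.coeFn_smul _ _).trans ((h2.const_smul c).trans (Eventually.of_forall fun x => ?_))
      simp [hf]
    · refine (Lp.coeFn_smul _ _).trans ((h3.const_smul c).trans (Eventually.of_forall fun x => ?_))
      simp [hf]
    · exact (Lp.coeFn_smul _ _).trans (h4.const_smul c)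

/-- `w` is the boundary trace of the function `u` of `H¹(disk)` with partial derivatives `p`, `q`:
the trace is the extension by continuity, for the norm of `H¹(disk)`, of the restriction to the
circle of functions that are smooth up to the boundary. -/
def IsTrace (u p q : L2Disk) (w : L2Circle) : Prop :=
  (u, p, q, w) ∈ smoothTraces.topologicalClosure

/-- The graph of `(u, w) ↦ (∂₁u, ∂₂u, ∂_τ w)` on the energy space
`V = {(u, w) ∈ H¹(disk) × H¹(circle) : w is the trace of u}`. -/
def energyGraph : Submodule ℂ (H × L2Disk × L2Disk × L2Circle) where
  carrier := {d | IsWeakPartial 1 d.1.fst d.2.1 ∧ IsWeakPartial Complex.I d.1.fst d.2.2.1 ∧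
    IsWeakTangential d.1.snd d.2.2.2 ∧ IsTrace d.1.fst d.2.1 d.2.2.1 d.1.snd}
  add_mem' := by
    rintro a b ⟨h1, h2, h3, h4⟩ ⟨k1, k2, k3, k4⟩
    refine ⟨fun φ hφ hc hs => ?_, fun φ hφ hc hs => ?_, fun φ hφ => ?_, ?_⟩
    · simp only [Prod.fst_add, Prod.snd_add, WithLp.add_fst]
      rw [integral_add_disk _ _ (continuous_fderiv hφ 1), integral_add_disk _ _ hφ.continuous]
      linear_combination h1 φ hφ hc hs + k1 φ hφ hc hs
    · simp only [Prod.fst_add, Prod.snd_add, WithLp.add_fst]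
      rw [integral_add_disk _ _ (continuous_fderiv hφ _), integral_add_disk _ _ hφ.continuous]
      linear_combination h2 φ hφ hc hs + k2 φ hφ hc hs
    · simp only [Prod.fst_add, Prod.snd_add, WithLp.add_snd]
      rw [integral_add_circle _ _ (continuous_tangentialDeriv hφ),
        integral_add_circle _ _ hφ.continuous]
      linear_combination h3 φ hφ + k3 φ hφ
    · exact smoothTraces.topologicalClosure.add_mem h4 k4
  zero_mem' := by
    refine ⟨fun φ _ _ _ => ?_, fun φ _ _ _ => ?_, fun φ _ => ?_, ?_⟩
    · simp only [Prod.fst_zero, Prod.snd_zero, WithLp.zero_fst]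
      rw [integral_zero_disk, integral_zero_disk, neg_zero]
    · simp only [Prod.fst_zero, Prod.snd_zero, WithLp.zero_fst]
      rw [integral_zero_disk, integral_zero_disk, neg_zero]
    · simp only [Prod.fst_zero, Prod.snd_zero, WithLp.zero_snd]
      rw [integral_zero_circle, integral_zero_circle, neg_zero]
    · exact smoothTraces.topologicalClosure.zero_mem
  smul_mem' := by
    rintro c a ⟨h1, h2, h3, h4⟩
    refine ⟨fun φ hφ hc hs => ?_, fun φ hφ hc hs => ?_, fun φ hφ => ?_, ?_⟩
    · simp only [Prod.smul_fst, Prod.smul_snd, WithLp.smul_fst]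
      rw [integral_smul_disk, integral_smul_disk]
      linear_combination c * h1 φ hφ hc hs
    · simp only [Prod.smul_fst, Prod.smul_snd, WithLp.smul_fst]
      rw [integral_smul_disk, integral_smul_disk]
      linear_combination c * h2 φ hφ hc hs
    · simp only [Prod.smul_fst, Prod.smul_snd, WithLp.smul_snd]
      rw [integral_smul_circle, integral_smul_circle]
      linear_combination c * h3 φ hφ
    · exact smoothTraces.topologicalClosure.smul_mem c h4

/-- The graph of the `H`-realization of `A`: the pairs `(U, F)` with `U ∈ V`, `F ∈ H` and
`∫ ∇U · conj ∇W dx + ∫ ∇_Γ U · conj ∇_Γ W dσ = ⟨F, W⟩_H` for all `W ∈ V`.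
(Mathlib's inner product is conjugate linear in its first argument.) -/
def stiffnessGraph : Submodule ℂ (H × H) where
  carrier := {d | ∃ g : L2Disk × L2Disk × L2Circle, (d.1, g) ∈ energyGraph ∧
    ∀ (W : H) (k : L2Disk × L2Disk × L2Circle), (W, k) ∈ energyGraph →
      inner ℂ k.1 g.1 + inner ℂ k.2.1 g.2.1 + inner ℂ k.2.2 g.2.2 = inner ℂ W d.2}
  add_mem' := by
    rintro ⟨U, F⟩ ⟨U', F'⟩ ⟨g, hg, h⟩ ⟨g', hg', h'⟩
    refine ⟨g + g', ?_, fun W k hk => ?_⟩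
    · have := energyGraph.add_mem hg hg'
      rwa [Prod.mk_add_mk] at this
    · have e1 : inner ℂ k.1 (g.1 + g'.1) = inner ℂ k.1 g.1 + inner ℂ k.1 g'.1 :=
        inner_add_right _ _ _
      have e2 : inner ℂ k.2.1 (g.2.1 + g'.2.1) = inner ℂ k.2.1 g.2.1 + inner ℂ k.2.1 g'.2.1 :=
        inner_add_right _ _ _
      have e3 : inner ℂ k.2.2 (g.2.2 + g'.2.2) = inner ℂ k.2.2 g.2.2 + inner ℂ k.2.2 g'.2.2 :=
        inner_add_right _ _ _
      have e4 : inner ℂ W (F + F') = inner ℂ W F + inner ℂ W F' := inner_add_right _ _ _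
      have a1 := h W k hk
      have a2 := h' W k hk
      change inner ℂ k.1 (g.1 + g'.1) + inner ℂ k.2.1 (g.2.1 + g'.2.1)
        + inner ℂ k.2.2 (g.2.2 + g'.2.2) = inner ℂ W (F + F')
      rw [e1, e2, e3, e4, ← a1, ← a2]
      ring
  zero_mem' := by
    refine ⟨0, energyGraph.zero_mem, fun W k hk => ?_⟩
    have e1 : inner ℂ k.1 (0 : L2Disk) = 0 := inner_zero_right _
    have e2 : inner ℂ k.2.1 (0 : L2Disk) = 0 := inner_zero_right _
    have e3 : inner ℂ k.2.2 (0 : L2Circle) = 0 := inner_zero_right _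
    have e4 : inner ℂ W (0 : H) = 0 := inner_zero_right _
    rw [Prod.fst_zero, Prod.snd_zero, Prod.fst_zero, Prod.snd_zero, Prod.snd_zero, e1, e2, e3, e4]
    ring
  smul_mem' := by
    rintro c ⟨U, F⟩ ⟨g, hg, h⟩
    refine ⟨c • g, ?_, fun W k hk => ?_⟩
    · have := energyGraph.smul_mem c hg
      rwa [Prod.smul_mk] at this
    · have e1 : inner ℂ k.1 (c • g.1) = c * inner ℂ k.1 g.1 := inner_smul_right _ _ _
      have e2 : inner ℂ k.2.1 (c • g.2.1) = c * inner ℂ k.2.1 g.2.1 := inner_smul_right _ _ _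
      have e3 : inner ℂ k.2.2 (c • g.2.2) = c * inner ℂ k.2.2 g.2.2 := inner_smul_right _ _ _
      have e4 : inner ℂ W (c • F) = c * inner ℂ W F := inner_smul_right _ _ _
      have a1 := h W k hk
      change inner ℂ k.1 (c • g.1) + inner ℂ k.2.1 (c • g.2.1) + inner ℂ k.2.2 (c • g.2.2)
        = inner ℂ W (c • F)
      rw [e1, e2, e3, e4, ← a1]
      ring

theorem isWeakPartial_of_smooth {φ : ℂ → ℂ} (hφ : ContDiff ℝ ∞ φ) {e : ℂ} {u g : L2Disk}
    (hu : u =ᵐ[volume.restrict disk] φ)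
    (hg : g =ᵐ[volume.restrict disk] fun x => fderiv ℝ φ x e) : IsWeakPartial e u g := by
  intro ψ hψ hc hs
  have h1 : ∫ x in disk, u x * fderiv ℝ ψ x e = ∫ x, φ x * fderiv ℝ ψ x e := by
    have h0 : ∀ x, x ∉ disk → φ x * fderiv ℝ ψ x e = 0 := fun x hx => by
      have : x ∉ tsupport (fderiv ℝ ψ) := fun h => hx (hs (tsupport_fderiv_subset ℝ h))
      rw [image_eq_zero_of_notMem_tsupport this]
      simp
    rw [← setIntegral_eq_integral_of_forall_compl_eq_zero h0]
    refine integral_congr_ae ?_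
    filter_upwards [hu] with x hx
    rw [hx]
  have h2 : ∫ x in disk, g x * ψ x = ∫ x, fderiv ℝ φ x e * ψ x := by
    have h0 : ∀ x, x ∉ disk → fderiv ℝ φ x e * ψ x = 0 := fun x hx => by
      have : x ∉ tsupport ψ := fun h => hx (hs h)
      rw [image_eq_zero_of_notMem_tsupport this, mul_zero]
    rw [← setIntegral_eq_integral_of_forall_compl_eq_zero h0]
    refine integral_congr_ae ?_
    filter_upwards [hg] with x hx
    rw [hx]
  rw [h1, h2]
  refine integral_mul_fderiv_eq_neg_fderiv_mul_of_integrable ?_ ?_ ?_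
    (fun x _ => hφ.differentiable (by simp) x) (fun x _ => hψ.differentiable (by simp) x)
  · exact ((continuous_fderiv hφ e).mul hψ.continuous).integrable_of_hasCompactSupport hc.mul_left
  · exact (hφ.continuous.mul (continuous_fderiv hψ e)).integrable_of_hasCompactSupport
      (hc.fderiv_apply ℝ e).mul_left
  · exact (hφ.continuous.mul hψ.continuous).integrable_of_hasCompactSupport hc.mul_left

theorem integral_arcLength {f : ℂ → ℂ} (hf : Continuous f) :
    ∫ x, f x ∂arcLength = ∫ θ in (-Real.pi)..Real.pi, f (Complex.exp (θ * Complex.I)) := by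
  rw [arcLength, integral_map (by fun_prop) hf.aestronglyMeasurable,
    intervalIntegral.integral_of_le (by linarith [Real.pi_pos])]

theorem isWeakTangential_of_smooth {φ : ℂ → ℂ} (hφ : ContDiff ℝ ∞ φ) {w t : L2Circle}
    (hw : w =ᵐ[arcLength] φ) (ht : t =ᵐ[arcLength] tangentialDeriv φ) :
    IsWeakTangential w t := by
  intro ψ hψ
  have h1 : ∫ x, w x * tangentialDeriv ψ x ∂arcLength
      = ∫ x, φ x * tangentialDeriv ψ x ∂arcLength := by
    refine integral_congr_ae ?_
    filter_upwards [hw] with x hx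
    rw [hx]
  have h2 : ∫ x, t x * ψ x ∂arcLength = ∫ x, tangentialDeriv φ x * ψ x ∂arcLength := by
    refine integral_congr_ae ?_
    filter_upwards [ht] with x hx
    rw [hx]
  have c1 : Continuous fun x => φ x * tangentialDeriv ψ x :=
    hφ.continuous.mul (continuous_tangentialDeriv hψ)
  have c2 : Continuous fun x => tangentialDeriv φ x * ψ x :=
    (continuous_tangentialDeriv hφ).mul hψ.continuous
  have hE : ∀ θ : ℝ, HasDerivAt (fun θ : ℝ => Complex.exp (θ * Complex.I))
      (Complex.I * Complex.exp (θ * Complex.I)) θ := by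
    intro θ
    have := ((Complex.ofRealCLM.hasDerivAt (x := θ)).mul_const Complex.I).cexp
    simpa [mul_comm] using this
  have hcE : Continuous fun θ : ℝ => Complex.exp (θ * Complex.I) := by fun_prop
  have hd : ∀ {χ : ℂ → ℂ}, ContDiff ℝ ∞ χ → ∀ θ : ℝ,
      HasDerivAt (fun θ : ℝ => χ (Complex.exp (θ * Complex.I)))
        (tangentialDeriv χ (Complex.exp (θ * Complex.I))) θ := by
    intro χ hχ θ
    exact (hχ.differentiable (by simp) _).hasFDerivAt.comp_hasDerivAt θ (hE θ)
  rw [h1, h2, integral_arcLength c1, integral_arcLength c2,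
    intervalIntegral.integral_mul_deriv_eq_deriv_mul (fun θ _ => hd hφ θ) (fun θ _ => hd hψ θ)
      (((continuous_tangentialDeriv hφ).comp hcE).intervalIntegrable _ _)
      (((continuous_tangentialDeriv hψ).comp hcE).intervalIntegrable _ _)]
  simp [Complex.exp_neg]

/-- Functions smooth up to the boundary belong to the energy space. -/
theorem smooth_mem_energyGraph {φ : ℂ → ℂ} (hφ : ContDiff ℝ ∞ φ) {U : H} {p q : L2Disk}
    {t : L2Circle} (hu : U.fst =ᵐ[volume.restrict disk] φ) (hw : U.snd =ᵐ[arcLength] φ)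
    (hp : p =ᵐ[volume.restrict disk] fun x => fderiv ℝ φ x 1)
    (hq : q =ᵐ[volume.restrict disk] fun x => fderiv ℝ φ x Complex.I)
    (ht : t =ᵐ[arcLength] tangentialDeriv φ) : (U, p, q, t) ∈ energyGraph :=
  ⟨isWeakPartial_of_smooth hφ hu hp, isWeakPartial_of_smooth hφ hu hq,
    isWeakTangential_of_smooth hφ hw ht,
    smoothTraces.le_topologicalClosure ⟨φ, hφ, hu, hp, hq, hw⟩⟩

theorem contDiff_ofReal {f : ℂ → ℝ} (hf : ContDiff ℝ ∞ f) :
    ContDiff ℝ ∞ fun x => (f x : ℂ) :=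
  Complex.ofRealCLM.contDiff.comp hf

theorem L2Disk_eq_zero {g : L2Disk} (h : ∀ f : ℂ → ℝ, ContDiff ℝ ∞ f → HasCompactSupport f →
    tsupport f ⊆ disk → ∫ x in disk, g x * (f x : ℂ) = 0) : g = 0 := by
  have hfin : IsFiniteMeasure ((volume : Measure ℂ).restrict disk) := ⟨by simp⟩
  have hint : IntegrableOn g disk := (Lp.memLp g).integrable (by norm_num)
  have key := Metric.isOpen_ball.ae_eq_zero_of_integral_contDiff_smul_eq_zero (U := disk)
    (μ := (volume : Measure ℂ)) hint.locallyIntegrableOn (fun f hf hc hs => by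
      rw [← h f hf hc hs, ← setIntegral_eq_integral_of_forall_compl_eq_zero (s := disk)]
      · exact integral_congr_ae (Eventually.of_forall fun x => by simp [mul_comm])
      · intro x hx
        have : x ∉ tsupport f := fun h => hx (hs h)
        rw [image_eq_zero_of_notMem_tsupport this, zero_smul])
  refine (Lp.eq_zero_iff_ae_eq_zero).2 ?_
  exact (ae_restrict_iff' Metric.isOpen_ball.measurableSet).2 key

theorem L2Circle_eq_zero {g : L2Circle} (h : ∀ f : ℂ → ℝ, ContDiff ℝ ∞ f → HasCompactSupport f →
    ∫ x, g x * (f x : ℂ) ∂arcLength = 0) : g = 0 := by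
  have hint : Integrable g arcLength := (Lp.memLp g).integrable (by norm_num)
  refine (Lp.eq_zero_iff_ae_eq_zero).2 ?_
  exact ae_eq_zero_of_integral_contDiff_smul_eq_zero hint.locallyIntegrable (fun f hf hc => by
    rw [← h f hf hc]
    exact integral_congr_ae (Eventually.of_forall fun x => by simp [mul_comm]))

/-- Weak derivatives are unique, and `V` is dense in `H`; hence `AU` is determined by `U`. -/
theorem stiffnessGraph_functional :
    ∀ d : H × H, d ∈ stiffnessGraph → d.1 = 0 → d.2 = 0 := by
  rintro ⟨U, F⟩ ⟨⟨p, q, t⟩, ⟨h1, h2, h3, -⟩, h⟩ hU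
  obtain rfl : U = 0 := hU
  have hp : p = 0 := L2Disk_eq_zero fun f hf hc hs => by
    have := h1 _ (contDiff_ofReal hf) (hc.comp_left Complex.ofReal_zero)
      ((tsupport_comp_subset Complex.ofReal_zero f).trans hs)
    simp only [WithLp.zero_fst] at this
    rw [integral_zero_disk] at this
    exact neg_eq_zero.1 this.symm
  have hq : q = 0 := L2Disk_eq_zero fun f hf hc hs => by
    have := h2 _ (contDiff_ofReal hf) (hc.comp_left Complex.ofReal_zero)
      ((tsupport_comp_subset Complex.ofReal_zero f).trans hs)
    simp only [WithLp.zero_fst] at this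
    rw [integral_zero_disk] at this
    exact neg_eq_zero.1 this.symm
  have ht : t = 0 := L2Circle_eq_zero fun f hf hc => by
    have := h3 _ (contDiff_ofReal hf)
    simp only [WithLp.zero_snd] at this
    rw [integral_zero_circle] at this
    exact neg_eq_zero.1 this.symm
  subst hp hq ht
  have key : ∀ f : ℂ → ℝ, ContDiff ℝ ∞ f →
      (∫ x in disk, F.fst x * (f x : ℂ)) + ∫ x, F.snd x * (f x : ℂ) ∂arcLength = 0 := by
    intro f hf
    have hφ := contDiff_ofReal hf
    have m1 := memLp_disk hφ.continuous
    have m2 := memLp_circle hφ.continuous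
    have := h (WithLp.toLp 2 (m1.toLp _, m2.toLp _))
      ((memLp_disk (continuous_fderiv hφ 1)).toLp _,
        (memLp_disk (continuous_fderiv hφ Complex.I)).toLp _,
        (memLp_circle (continuous_tangentialDeriv hφ)).toLp _)
      (smooth_mem_energyGraph hφ m1.coeFn_toLp m2.coeFn_toLp (MemLp.coeFn_toLp _)
        (MemLp.coeFn_toLp _) (MemLp.coeFn_toLp _))
    simp only [inner_zero_right, add_zero, WithLp.prod_inner_apply] at this
    rw [L2.inner_def, L2.inner_def] at this
    rw [this]
    congr 1
    · refine integral_congr_ae ?_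
      filter_upwards [m1.coeFn_toLp] with x hx
      simp [hx]
    · refine integral_congr_ae ?_
      filter_upwards [m2.coeFn_toLp] with x hx
      simp [hx]
  have hF1 : F.fst = 0 := L2Disk_eq_zero fun f hf hc hs => by
    have := key f hf
    rwa [integral_eq_zero_of_ae (μ := arcLength), add_zero] at this
    filter_upwards [ae_arcLength] with x hx
    have : x ∉ tsupport f := fun h => by
      have := hs h
      simp [hx] at this
    simp [image_eq_zero_of_notMem_tsupport this]
  have hF2 : F.snd = 0 := L2Circle_eq_zero fun f hf hc => by
    have := key f hf
    rwa [hF1, integral_zero_disk, zero_add] at this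
  exact WithLp.ofLp_injective 2 (Prod.ext hF1 hF2)

/-- The unbounded operator `A` on `H`, acting as `(u, w) ↦ (-Δu, -Δ_Γ w + ∂_ν u)`, with domain
`{U ∈ V : AU ∈ H}`. -/
def A : H →ₗ.[ℂ] H := stiffnessGraph.toLinearPMap

/-- The control operator `B e = (0, e)`. -/
def B : L2Circle →L[ℂ] H :=
  (WithLp.prodContinuousLinearEquiv 2 ℂ L2Disk L2Circle).symm.toContinuousLinearMap ∘L
    ContinuousLinearMap.inr ℂ L2Disk L2Circle

/-- The quadratic operator pencil `P(z) = A + z B B* + z²`, with domain that of `A`. -/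
def pencil (z : ℂ) : A.domain →ₗ[ℂ] H :=
  A.toFun + z • ((B ∘L ContinuousLinearMap.adjoint B).toLinearMap ∘ₗ A.domain.subtype)
    + z ^ 2 • A.domain.subtype

/-- `u` is an eigenvector of the pencil associated with `z`. -/
def IsEigenvector (z : ℂ) (u : A.domain) : Prop := u ≠ 0 ∧ pencil z u = 0

/-- `z` is an eigenvalue of the pencil. -/
def IsEigenvalue (z : ℂ) : Prop := ∃ u : A.domain, IsEigenvector z u

/-- The bounded operator `R` on `H` is the inverse `P(z)⁻¹`. -/
def IsPencilInverse (z : ℂ) (R : H →L[ℂ] H) : Prop :=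
  (∀ u : A.domain, R (pencil z u) = u) ∧
    ∀ F : H, ∃ u : A.domain, (u : H) = R F ∧ pencil z u = F

/-- The Bessel function of the first kind of order `n`. -/
def besselJ (n : ℕ) (z : ℂ) : ℂ :=
  ∑' m : ℕ, (-1) ^ m / ((m.factorial : ℂ) * ((m + n).factorial : ℂ)) * (z / 2) ^ (2 * m + n)

/-- The leading part `kπ - π/4` of the roots. -/
def phase (k : ℕ) : ℝ := k * Real.pi - Real.pi / 4

/-- `lam` is a sequence (of which only the terms with large index matter) of complex roots of
`(iλ - λ²) J₀(λ) + λ J₀'(λ) = 0` such that, writing `φ_k = kπ - π/4`,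
`λ_k = φ_k + 1 / (8 φ_k) + φ_k / (1 + φ_k²) + i / (1 + φ_k²) + O(1 / k³)`. -/
def IsRootSequence (lam : ℕ → ℂ) : Prop :=
  (∀ᶠ k in atTop, (Complex.I * lam k - lam k ^ 2) * besselJ 0 (lam k)
      + lam k * deriv (besselJ 0) (lam k) = 0) ∧
  (fun k : ℕ => lam k - ((phase k : ℂ) + 1 / (8 * (phase k : ℂ))
      + (phase k : ℂ) / (1 + (phase k : ℂ) ^ 2) + Complex.I / (1 + (phase k : ℂ) ^ 2)))
    =O[atTop] (fun k : ℕ => 1 / (k : ℝ) ^ 3)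

/-- `U ∈ H` is the radial function `f(|x|)`, both in the disk and on the circle. -/
def IsRadial (U : H) (f : ℝ → ℂ) : Prop :=
  U.fst =ᵐ[volume.restrict disk] (fun x => f ‖x‖) ∧ U.snd =ᵐ[arcLength] (fun x => f ‖x‖)

end WaveDisk

end

/-!
The function `u(x) = J₀(λ|x|)` satisfies `-Δu = λ²u`, its restriction to the circle is constant,
and its normal derivative there is `λ J₀'(λ)`. Hence `P(iλ)u` vanishes inside the disk, and on the
circle it equals `λ J₀'(λ) + (iλ - λ²) J₀(λ)`: every root of the characteristic equation gives a radial
eigenvector (`exists_radial_eigenvector`). That the weak formulation of `A` agrees with this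
computation is Green's formula for radial fields, obtained in polar coordinates for test functions
smooth up to the boundary (`integral_disk_radial_divergence`) and extended to all of `V` by the
definition of the trace as a closure.

The roots come from real zeros of `J₀`. On the positive axis, Bessel's integral over `[-1, 1]` is
moved by Cauchy's theorem to the two vertical half-lines above `±1` (`pi_mul_besselJ_zero`), where
Watson's lemma gives Hankel's expansion with a relative error `O(x⁻³)` (`besselJ_zero_hankel`). The
intermediate value theorem then yields McMahon's expansion `j = φ + 1/(8φ) + O(φ⁻³)` of the zeros,
`φ = kπ - π/4` (`exists_besselJ_zero_near_phase`). Near such a zero `j`, Bessel's equation and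
Grönwall's inequality give `J₀(j + h) ≈ J₀'(j) h` and `J₀'(j + h) ≈ J₀'(j)`, for complex `h` of size
`1/j`, so that the characteristic equation `(λ - i) J₀(λ) = J₀'(λ)` is a perturbation of
`h = 1/(j - i)`. A quantitative open mapping theorem solves it up to `O(j⁻³)`
(`exists_root_near_besselJ_zero`), and `1/(φ - i) = φ/(1 + φ²) + i/(1 + φ²)`.

Finally, `Im λ_k = O(k⁻²)` for every root sequence. For a normalized eigenvector `u` associated with
`iλ`, the vector `P(i Re λ)u = (P(i Re λ) - P(iλ))u` has norm at most a constant times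
`|Im λ| (1 + |λ|)`, that is `O(1/ω)` (`norm_pencil_re_le`). A bounded inverse of `P(iω)` maps this
short vector back to the unit vector `u`, so its norm is at least of order `ω`.
-/

namespace WaveDisk

/-! ### The Bessel functions as entire functions -/

/-- The coefficient of `(w / 4) ^ m` in the entire function `w ↦ J_n(√w) / (√w / 2) ^ n`. -/
noncomputable def besselCoeff (n m : ℕ) : ℂ :=
  (-1) ^ m / ((m.factorial : ℂ) * ((m + n).factorial : ℂ))

/-- The entire function `h_n` with `J_n(z) = (z / 2) ^ n * h_n(z ^ 2)`. -/
noncomputable def reducedBessel (n : ℕ) (w : ℂ) : ℂ := ∑' m : ℕ, besselCoeff n m * (w / 4) ^ m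

theorem norm_besselCoeff_le (n m : ℕ) : ‖besselCoeff n m‖ ≤ 1 / (m.factorial : ℝ) := by
  have h1 : (1 : ℝ) ≤ ((m + n).factorial : ℝ) := by
    exact_mod_cast Nat.succ_le_of_lt (Nat.factorial_pos _)
  have h2 : (0 : ℝ) < (m.factorial : ℝ) := by exact_mod_cast Nat.factorial_pos _
  simp only [besselCoeff, norm_div, norm_pow, norm_neg, norm_one, one_pow, norm_mul,
    Complex.norm_natCast]
  exact one_div_le_one_div_of_le h2 (le_mul_of_one_le_right h2.le h1)

theorem summable_reducedBessel (n : ℕ) (w : ℂ) :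
    Summable fun m : ℕ => besselCoeff n m * (w / 4) ^ m := by
  refine Summable.of_norm_bounded (Real.summable_pow_div_factorial ‖w / 4‖) fun m => ?_
  rw [norm_mul, norm_pow, div_eq_inv_mul (‖w / 4‖ ^ m), ← one_div]
  exact mul_le_mul_of_nonneg_right (norm_besselCoeff_le n m) (by positivity)

theorem succ_mul_besselCoeff (n m : ℕ) :
    ((m + 1 : ℕ) : ℂ) * besselCoeff n (m + 1) = -besselCoeff (n + 1) m := by
  have h1 : ((m + 1 : ℕ) : ℂ) ≠ 0 := by exact_mod_cast Nat.succ_ne_zero m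
  have h2 : (m.factorial : ℂ) ≠ 0 := by exact_mod_cast Nat.factorial_ne_zero _
  have h3 : ((m + (n + 1)).factorial : ℂ) ≠ 0 := by exact_mod_cast Nat.factorial_ne_zero _
  have h4 : m + 1 + n = m + (n + 1) := by ring
  rw [besselCoeff, besselCoeff, Nat.factorial_succ, h4]
  push_cast at h1 ⊢
  field_simp
  ring

theorem hasDerivAt_reducedBessel (n : ℕ) (w : ℂ) :
    HasDerivAt (reducedBessel n) (-(1 / 4) * reducedBessel (n + 1) w) w := by
  obtain ⟨R, hR⟩ := exists_gt ‖w‖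
  have hR0 : 0 ≤ R := (norm_nonneg w).trans hR.le
  have hu : Summable fun m : ℕ => (R / 4) ^ (m - 1) / ((m - 1).factorial : ℝ) := by
    rw [← summable_nat_add_iff 1]
    simpa using Real.summable_pow_div_factorial (R / 4)
  have key : HasDerivAt (reducedBessel n)
      (∑' m : ℕ, besselCoeff n m * (m * (w / 4) ^ (m - 1) * (1 / 4))) w := by
    refine hasDerivAt_tsum_of_isPreconnected hu Metric.isOpen_ball
      (convex_ball (0 : ℂ) R).isPreconnected (g := fun m w => besselCoeff n m * (w / 4) ^ m)
      (g' := fun m w => besselCoeff n m * (m * (w / 4) ^ (m - 1) * (1 / 4)))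
      (fun m y _ => ?_) (fun m y hy => ?_) (y₀ := w) (by simpa using hR)
      (summable_reducedBessel n w) (by simpa using hR)
    · exact (((hasDerivAt_id y).div_const 4).pow m).const_mul _
    · have hy' : ‖y‖ ≤ R := by simpa using (Metric.mem_ball.1 hy).le
      rcases m with _ | m
      · simp
      · have : besselCoeff n (m + 1) * (((m + 1 : ℕ) : ℂ) * (y / 4) ^ (m + 1 - 1) * (1 / 4))
            = -besselCoeff (n + 1) m * (y / 4) ^ m * (1 / 4) := by
          rw [← succ_mul_besselCoeff, Nat.add_sub_cancel]
          ring
        rw [this, norm_mul, norm_mul, norm_neg, norm_pow, norm_div, Nat.add_sub_cancel,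
          div_eq_inv_mul ((R / 4) ^ m), ← one_div]
        have h4 : ‖(4 : ℂ)‖ = 4 := by norm_num
        have h5 : ‖(1 / 4 : ℂ)‖ ≤ 1 := by norm_num
        rw [h4]
        calc _ ≤ 1 / (m.factorial : ℝ) * (R / 4) ^ m * 1 := by
              gcongr
              exact norm_besselCoeff_le _ _
          _ = _ := mul_one _
  convert key using 1
  have hs : Summable fun m : ℕ => besselCoeff n m * (m * (w / 4) ^ (m - 1) * (1 / 4)) := by
    rw [← summable_nat_add_iff 1]
    refine ((summable_reducedBessel (n + 1) w).mul_left (-(1 / 4))).congr fun m => ?_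
    rw [← neg_eq_iff_eq_neg.2 (succ_mul_besselCoeff n m), Nat.add_sub_cancel]
    ring
  rw [hs.tsum_eq_zero_add, reducedBessel, ← tsum_mul_left]
  simp only [Nat.cast_zero, zero_mul, mul_zero, zero_add]
  refine tsum_congr fun m => ?_
  rw [← neg_eq_iff_eq_neg.2 (succ_mul_besselCoeff n m), Nat.add_sub_cancel]
  ring

/-- The three-term recurrence of the Bessel functions. -/
theorem reducedBessel_recurrence (n : ℕ) (w : ℂ) :
    reducedBessel n w = (n + 1) * reducedBessel (n + 1) w - w / 4 * reducedBessel (n + 2) w := by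
  have hs := summable_reducedBessel (n + 1) w
  have hs2 : Summable fun m : ℕ => m * (besselCoeff (n + 1) m * (w / 4) ^ m) := by
    rw [← summable_nat_add_iff 1]
    refine ((summable_reducedBessel (n + 2) w).mul_left (-(w / 4))).congr fun m => ?_
    linear_combination (-(w / 4) ^ (m + 1)) * succ_mul_besselCoeff (n + 1) m
  have e2 : ∑' m : ℕ, m * (besselCoeff (n + 1) m * (w / 4) ^ m)
      = -(w / 4) * reducedBessel (n + 2) w := by
    rw [hs2.tsum_eq_zero_add, reducedBessel, ← tsum_mul_left]
    simp only [Nat.cast_zero, zero_mul, zero_add]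
    refine tsum_congr fun m => ?_
    linear_combination ((w / 4) ^ (m + 1)) * succ_mul_besselCoeff (n + 1) m
  rw [sub_eq_add_neg, ← neg_mul, ← e2, reducedBessel, reducedBessel, ← tsum_mul_left,
    ← (hs.mul_left _).tsum_add hs2]
  refine tsum_congr fun m => ?_
  have h2 : (m.factorial : ℂ) ≠ 0 := by exact_mod_cast Nat.factorial_ne_zero _
  have h3 : ((m + n).factorial : ℂ) ≠ 0 := by exact_mod_cast Nat.factorial_ne_zero _
  have h4 : ((m + n + 1 : ℕ) : ℂ) ≠ 0 := by exact_mod_cast Nat.succ_ne_zero (m + n)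
  have h5 : m + (n + 1) = m + n + 1 := by ring
  have : besselCoeff n m = (n + 1 + m) * besselCoeff (n + 1) m := by
    rw [besselCoeff, besselCoeff, h5, Nat.factorial_succ (m + n)]
    push_cast at h4 ⊢
    field_simp
    ring
  rw [this]
  ring

theorem reducedBessel_zero_zero : reducedBessel 0 0 = 1 := by
  rw [reducedBessel, tsum_eq_single 0 (fun m hm => by simp [hm])]
  simp [besselCoeff]

theorem differentiable_reducedBessel (n : ℕ) : Differentiable ℂ (reducedBessel n) :=
  fun w => (hasDerivAt_reducedBessel n w).differentiableAt

theorem contDiff_reducedBessel (n : ℕ) : ContDiff ℂ ∞ (reducedBessel n) :=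
  (differentiable_reducedBessel n).contDiff

theorem besselJ_zero_eq (z : ℂ) : besselJ 0 z = reducedBessel 0 (z ^ 2) := by
  rw [besselJ, reducedBessel]
  refine tsum_congr fun m => ?_
  rw [besselCoeff, add_zero, add_zero, pow_mul, div_pow z 2 2]
  norm_num

theorem hasDerivAt_besselJ_zero (z : ℂ) :
    HasDerivAt (besselJ 0) (-(z / 2) * reducedBessel 1 (z ^ 2)) z := by
  rw [funext besselJ_zero_eq]
  refine ((hasDerivAt_reducedBessel 0 (z ^ 2)).comp z (hasDerivAt_pow 2 z)).congr_deriv ?_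
  norm_num
  ring

theorem deriv_besselJ_zero (z : ℂ) :
    deriv (besselJ 0) z = -(z / 2) * reducedBessel 1 (z ^ 2) :=
  (hasDerivAt_besselJ_zero z).deriv

theorem differentiable_besselJ_zero : Differentiable ℂ (besselJ 0) :=
  fun z => (hasDerivAt_besselJ_zero z).differentiableAt

/-- Bessel's equation of order `0`, as a formula for the second derivative. -/
theorem hasDerivAt_deriv_besselJ_zero {z : ℂ} (hz : z ≠ 0) :
    HasDerivAt (deriv (besselJ 0)) (-besselJ 0 z - deriv (besselJ 0) z / z) z := by
  have e : deriv (besselJ 0) = fun z => -(z / 2) * reducedBessel 1 (z ^ 2) :=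
    funext deriv_besselJ_zero
  have h1 := (hasDerivAt_reducedBessel 1 (z ^ 2)).comp z (hasDerivAt_pow 2 z)
  have h2 := ((hasDerivAt_id z).div_const 2).neg.mul h1
  rw [e]
  refine h2.congr_deriv ?_
  have h3 := reducedBessel_recurrence 0 (z ^ 2)
  rw [besselJ_zero_eq, h3]
  simp
  field_simp
  ring

/-! ### Green's formula on the disk for radial vector fields -/

/-- The divergence theorem on the unit disk for the vector field `x ↦ ψ(x) a(|x|) x`, where
`b(|x|)` is the divergence of `a(|x|) x`. -/
theorem integral_disk_radial_divergence {a b : ℝ → ℂ} (ha : Continuous a) (hb : Continuous b)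
    (hab : ∀ r : ℝ, HasDerivAt (fun r : ℝ => (r : ℂ) ^ 2 * a r) (r * b r) r) {ψ : ℂ → ℂ}
    (hψ : ContDiff ℝ ∞ ψ) :
    ∫ x in disk, (fderiv ℝ ψ x x * a ‖x‖ + ψ x * b ‖x‖) = ∫ x, a 1 * ψ x ∂arcLength := by
  set F : ℂ → ℂ := fun x => fderiv ℝ ψ x x * a ‖x‖ + ψ x * b ‖x‖ with hF
  have hFc : Continuous F :=
    (((hψ.continuous_fderiv (by simp)).clm_apply continuous_id).mul (ha.comp continuous_norm)).add
      (hψ.continuous.mul (hb.comp continuous_norm))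
  set E : ℝ → ℂ := fun θ => Complex.exp (θ * Complex.I) with hE
  have hEc : Continuous E := by fun_prop
  have hnE : ∀ θ, ‖E θ‖ = 1 := fun θ => Complex.norm_exp_ofReal_mul_I θ
  set P : ℝ × ℝ → ℂ := fun p => (p.1 : ℂ) * F (p.1 * E p.2) with hP
  have hPc : Continuous P := by fun_prop
  have h1 : ∫ x in disk, F x
      = ∫ p in Set.Ioo (0 : ℝ) 1 ×ˢ Set.Ioo (-Real.pi) Real.pi, P p := by
    rw [← integral_indicator Metric.isOpen_ball.measurableSet,
      ← Complex.integral_comp_polarCoord_symm]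
    have hset : polarCoord.target ∩ (Set.Iio (1 : ℝ) ×ˢ Set.univ)
        = Set.Ioo (0 : ℝ) 1 ×ˢ Set.Ioo (-Real.pi) Real.pi := by
      ext p
      simp [polarCoord_target]
      tauto
    rw [← hset, ← setIntegral_indicator (measurableSet_Iio.prod MeasurableSet.univ)]
    refine setIntegral_congr_fun polarCoord.open_target.measurableSet fun p hp => ?_
    have hp0 : 0 < p.1 := by
      rw [polarCoord_target] at hp
      exact hp.1
    have hs : Complex.polarCoord.symm p = p.1 * E p.2 := by
      rw [Complex.polarCoord_symm_apply, hE]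
      simp only [Complex.exp_mul_I]
      push_cast
      ring
    have hn : ‖(p.1 : ℂ) * E p.2‖ = p.1 := by
      rw [norm_mul, hnE, mul_one, Complex.norm_real, Real.norm_of_nonneg hp0.le]
    simp only [hs]
    by_cases h : p.1 < 1
    · rw [Set.indicator_of_mem, Set.indicator_of_mem]
      · simp [hP]
      · exact ⟨h, Set.mem_univ _⟩
      · rw [mem_ball_zero_iff, hn]
        exact h
    · rw [Set.indicator_of_notMem, Set.indicator_of_notMem]
      · simp
      · exact fun h' => h h'.1
      · rw [mem_ball_zero_iff, hn]
        exact h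
  have hint : IntegrableOn P (Set.Ioo (0 : ℝ) 1 ×ˢ Set.Ioo (-Real.pi) Real.pi) :=
    (hPc.continuousOn.integrableOn_compact (isCompact_Icc.prod isCompact_Icc)).mono_set
      (Set.prod_mono (Set.Ioo_subset_Icc_self (a := (0 : ℝ)) (b := 1))
        (Set.Ioo_subset_Icc_self (a := -Real.pi) (b := Real.pi)))
  have hinner : ∀ θ : ℝ, ∫ r in Set.Ioo (0 : ℝ) 1, P (r, θ) = a 1 * ψ (E θ) := by
    intro θ
    rw [← integral_Ioc_eq_integral_Ioo, ← intervalIntegral.integral_of_le zero_le_one]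
    have hd : ∀ r ∈ Set.uIcc (0 : ℝ) 1,
        HasDerivAt (fun r : ℝ => (r : ℂ) ^ 2 * a r * ψ (r * E θ)) (P (r, θ)) r := by
      intro r hr
      rw [Set.uIcc_of_le zero_le_one] at hr
      have hline : HasDerivAt (fun r : ℝ => (r : ℂ) * E θ) (E θ) r := by
        simpa using (Complex.ofRealCLM.hasDerivAt (x := r)).mul_const (E θ)
      have hψd := (hψ.differentiable (by simp) (r * E θ)).hasFDerivAt.comp_hasDerivAt r hline
      have hn : ‖(r : ℂ) * E θ‖ = r := by
        rw [norm_mul, hnE, mul_one, Complex.norm_real, Real.norm_of_nonneg hr.1]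
      have hlin : fderiv ℝ ψ (r * E θ) (r * E θ) = r * fderiv ℝ ψ (r * E θ) (E θ) := by
        have := (fderiv ℝ ψ (r * E θ)).map_smul r (E θ)
        simpa using this
      refine ((hab r).mul hψd).congr_deriv ?_
      simp only [hP, hF, hn, hlin, Function.comp]
      ring
    rw [intervalIntegral.integral_eq_sub_of_hasDerivAt hd
      ((hPc.comp (by fun_prop : Continuous fun r : ℝ => (r, θ))).intervalIntegrable _ _)]
    simp
  rw [h1, Measure.volume_eq_prod, ← Measure.prod_restrict, integral_prod_symm]
  · simp only [hinner]
    rw [← integral_Ioc_eq_integral_Ioo,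
      ← intervalIntegral.integral_of_le (by linarith [Real.pi_pos]),
      integral_arcLength (hψ.continuous.const_mul (a 1))]
  · rwa [Measure.prod_restrict, ← Measure.volume_eq_prod]

/-! ### The radial eigenvectors -/

/-- The radial function `x ↦ J₀(l |x|)`, written so that it is visibly smooth at the origin. -/
noncomputable def radialBessel (l x : ℂ) : ℂ := reducedBessel 0 (l ^ 2 * ((‖x‖ ^ 2 : ℝ) : ℂ))

/-- The gradient of `radialBessel l` at `x` is `radialSlope l |x|` times `x`. -/
noncomputable def radialSlope (l : ℂ) (r : ℝ) : ℂ :=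
  -(l ^ 2 / 2) * reducedBessel 1 (l ^ 2 * ((r ^ 2 : ℝ) : ℂ))

theorem radialBessel_eq (l x : ℂ) : radialBessel l x = besselJ 0 (l * (‖x‖ : ℂ)) := by
  rw [radialBessel, besselJ_zero_eq, mul_pow]
  push_cast
  rfl

theorem contDiff_radialBessel (l : ℂ) : ContDiff ℝ ∞ (radialBessel l) :=
  ((contDiff_reducedBessel 0).restrict_scalars ℝ).comp
    (contDiff_const.mul (contDiff_ofReal (contDiff_norm_sq ℝ)))

theorem continuous_reducedBessel (n : ℕ) : Continuous (reducedBessel n) :=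
  (differentiable_reducedBessel n).continuous

theorem continuous_radialSlope (l : ℂ) : Continuous (radialSlope l) :=
  continuous_const.mul ((continuous_reducedBessel 1).comp (by fun_prop))

theorem fderiv_radialBessel (l x e : ℂ) :
    fderiv ℝ (radialBessel l) x e = radialSlope l ‖x‖ * (inner ℝ x e : ℝ) := by
  have h1 : HasFDerivAt (fun y : ℂ => ‖y‖ ^ 2) (2 • innerSL ℝ x) x :=
    (hasStrictFDerivAt_norm_sq x).hasFDerivAt
  have h2 : HasDerivAt (fun t : ℝ => reducedBessel 0 (l ^ 2 * (t : ℂ)))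
      (-(1 / 4) * reducedBessel 1 (l ^ 2 * ((‖x‖ ^ 2 : ℝ) : ℂ)) * l ^ 2) (‖x‖ ^ 2) := by
    have h3 : HasDerivAt (fun t : ℝ => l ^ 2 * (t : ℂ)) (l ^ 2) (‖x‖ ^ 2) := by
      simpa using (Complex.ofRealCLM.hasDerivAt (x := ‖x‖ ^ 2)).const_mul (l ^ 2)
    exact (hasDerivAt_reducedBessel 0 _).comp (‖x‖ ^ 2) h3
  have h4 := h2.hasFDerivAt.comp x h1
  have h5 : HasFDerivAt (radialBessel l) _ x := h4
  rw [h5.fderiv, radialSlope]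
  simp
  ring

theorem hasDerivAt_sq_mul_radialSlope (l : ℂ) (r : ℝ) :
    HasDerivAt (fun r : ℝ => (r : ℂ) ^ 2 * radialSlope l r)
      (r * (-l ^ 2 * reducedBessel 0 (l ^ 2 * ((r ^ 2 : ℝ) : ℂ)))) r := by
  have h0 : HasDerivAt (fun t : ℝ => (t : ℂ) ^ 2) (2 * r) r := by
    have := (Complex.ofRealCLM.hasDerivAt (x := r)).pow 2
    exact this.congr_deriv (by simp)
  have h1 : HasDerivAt (fun t : ℝ => l ^ 2 * ((t ^ 2 : ℝ) : ℂ)) (l ^ 2 * (2 * r)) r := by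
    simpa using h0.const_mul (l ^ 2)
  have h2 := h0.mul (((hasDerivAt_reducedBessel 1 _).comp r h1).const_mul (-(l ^ 2 / 2)))
  refine h2.congr_deriv ?_
  have h3 := reducedBessel_recurrence 0 (l ^ 2 * ((r ^ 2 : ℝ) : ℂ))
  rw [h3]
  simp
  ring

/-- Green's formula for `radialBessel l`, with `-Δ u = l² u` and `∂_ν u = radialSlope l 1`. -/
theorem integral_fderiv_mul_fderiv_radialBessel (l : ℂ) {ψ : ℂ → ℂ} (hψ : ContDiff ℝ ∞ ψ) :
    (∫ x in disk, fderiv ℝ (radialBessel l) x 1 * fderiv ℝ ψ x 1)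
        + ∫ x in disk, fderiv ℝ (radialBessel l) x Complex.I * fderiv ℝ ψ x Complex.I
      = (∫ x in disk, l ^ 2 * radialBessel l x * ψ x)
        + ∫ x, radialSlope l 1 * ψ x ∂arcLength := by
  have hfin : IsFiniteMeasure ((volume : Measure ℂ).restrict disk) := ⟨by simp⟩
  have hi : ∀ {f : ℂ → ℂ}, Continuous f → Integrable f (volume.restrict disk) := fun hf =>
    (memLp_disk hf).integrable (by norm_num)
  have hu := contDiff_radialBessel l
  have hpair : ∀ e, Continuous fun x => fderiv ℝ (radialBessel l) x e * fderiv ℝ ψ x e := fun e =>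
    (continuous_fderiv hu e).mul (continuous_fderiv hψ e)
  have hb : Continuous fun r : ℝ => -l ^ 2 * reducedBessel 0 (l ^ 2 * ((r ^ 2 : ℝ) : ℂ)) :=
    continuous_const.mul ((continuous_reducedBessel 0).comp (by fun_prop))
  have hc1 : Continuous fun x => l ^ 2 * radialBessel l x * ψ x :=
    (continuous_const.mul hu.continuous).mul hψ.continuous
  have hc2 : Continuous fun x => fderiv ℝ ψ x x * radialSlope l ‖x‖
      + ψ x * (-l ^ 2 * reducedBessel 0 (l ^ 2 * ((‖x‖ ^ 2 : ℝ) : ℂ))) :=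
    (((hψ.continuous_fderiv (by simp)).clm_apply continuous_id).mul
      ((continuous_radialSlope l).comp continuous_norm)).add
      (hψ.continuous.mul (hb.comp continuous_norm))
  rw [← integral_disk_radial_divergence (continuous_radialSlope l) hb
    (hasDerivAt_sq_mul_radialSlope l) hψ, ← integral_add (hi (hpair 1)) (hi (hpair Complex.I)),
    ← integral_add (hi hc1) (hi hc2)]
  refine integral_congr_ae (Eventually.of_forall fun x => ?_)
  have hx : fderiv ℝ ψ x x = x.re * fderiv ℝ ψ x 1 + x.im * fderiv ℝ ψ x Complex.I := by
    have h := (fderiv ℝ ψ x).map_add (x.re • (1 : ℂ)) (x.im • Complex.I)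
    have e : x.re • (1 : ℂ) + x.im • Complex.I = x := by
      simp [Complex.re_add_im]
    rw [e, map_smul, map_smul] at h
    simpa using h
  simp only [fderiv_radialBessel, hx, radialBessel, Complex.inner]
  simp
  ring

theorem tangentialDeriv_radialBessel (l x : ℂ) : tangentialDeriv (radialBessel l) x = 0 := by
  rw [tangentialDeriv, fderiv_radialBessel]
  simp [Complex.inner, mul_comm]

/-- The function `x ↦ J₀(l |x|)` is in the domain of `A`, and `A` maps it to
`(l² u, radialSlope l 1)`. -/
theorem radialBessel_mem_stiffnessGraph (l : ℂ) {U F : H}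
    (hu : U.fst =ᵐ[volume.restrict disk] radialBessel l) (hw : U.snd =ᵐ[arcLength] radialBessel l)
    (hF : F.fst =ᵐ[volume.restrict disk] fun x => l ^ 2 * radialBessel l x)
    (hFw : F.snd =ᵐ[arcLength] fun _ => radialSlope l 1) : (U, F) ∈ stiffnessGraph := by
  have hs := contDiff_radialBessel l
  have m1 := memLp_disk (continuous_fderiv hs 1)
  have m2 := memLp_disk (continuous_fderiv hs Complex.I)
  refine ⟨(m1.toLp _, m2.toLp _, 0), ?_, ?_⟩
  · refine smooth_mem_energyGraph hs hu hw m1.coeFn_toLp m2.coeFn_toLp ?_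
    rw [funext (tangentialDeriv_radialBessel l)]
    exact Lp.coeFn_zero _ _ _
  · rintro W ⟨p, q, t⟩ ⟨-, -, -, htr⟩
    -- by the definition of the trace, it suffices to test with functions smooth up to the boundary
    have hclosed : IsClosed {d : L2Disk × L2Disk × L2Disk × L2Circle |
        inner ℂ d.2.1 (m1.toLp _) + inner ℂ d.2.2.1 (m2.toLp _)
          = inner ℂ d.1 F.fst + inner ℂ d.2.2.2 F.snd} := by
      refine isClosed_eq ?_ ?_ <;> fun_prop
    have hsub : (smoothTraces : Set (L2Disk × L2Disk × L2Disk × L2Circle)) ⊆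
        {d | inner ℂ d.2.1 (m1.toLp _) + inner ℂ d.2.2.1 (m2.toLp _)
          = inner ℂ d.1 F.fst + inner ℂ d.2.2.2 F.snd} := by
      rintro ⟨d1, d2, d3, d4⟩ ⟨φ, hφ, k1, k2, k3, k4⟩
      dsimp only at k1 k2 k3 k4
      set ψ : ℂ → ℂ := fun x => conj (φ x) with hψ
      have hψs : ContDiff ℝ ∞ ψ := Complex.conjCLE.contDiff.comp hφ
      have hψd : ∀ x e, fderiv ℝ ψ x e = conj (fderiv ℝ φ x e) := by
        intro x e
        have := Complex.conjCLE.toContinuousLinearMap.hasFDerivAt.comp x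
          (hφ.differentiable (by simp) x).hasFDerivAt
        have h2 : HasFDerivAt ψ _ x := this
        rw [h2.fderiv]
        simp
      have key := integral_fderiv_mul_fderiv_radialBessel l hψs
      change inner ℂ d2 (m1.toLp _) + inner ℂ d3 (m2.toLp _)
          = inner ℂ d1 F.fst + inner ℂ d4 F.snd
      rw [L2.inner_def, L2.inner_def, L2.inner_def, L2.inner_def]
      convert key using 2
      · refine integral_congr_ae ?_
        filter_upwards [k2, m1.coeFn_toLp] with x h1 h2
        rw [h1, h2, hψd]
        simp
      · refine integral_congr_ae ?_
        filter_upwards [k3, m2.coeFn_toLp] with x h1 h2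
        rw [h1, h2, hψd]
        simp
      · refine integral_congr_ae ?_
        filter_upwards [k1, hF] with x h1 h2
        rw [h1, h2]
        simp [hψ]
      · refine integral_congr_ae ?_
        filter_upwards [k4, hFw] with x h1 h2
        rw [h1, h2]
        simp [hψ]
    have htr' := closure_minimal hsub hclosed htr
    have e : inner ℂ t (0 : L2Circle) = 0 := inner_zero_right _
    simp only [WithLp.prod_inner_apply] at htr' ⊢
    rw [e, add_zero]
    exact htr'

theorem B_apply (e : L2Circle) : B e = WithLp.toLp 2 (0, e) := rfl

theorem adjoint_B_apply (U : H) : ContinuousLinearMap.adjoint B U = U.snd := by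
  refine ext_inner_left ℂ fun e => ?_
  rw [ContinuousLinearMap.adjoint_inner_right, B_apply, WithLp.prod_inner_apply]
  simp

theorem pencil_apply (z : ℂ) (u : A.domain) :
    pencil z u = A u + z • (WithLp.toLp 2 (0, (u : H).snd) : H) + z ^ 2 • (u : H) := by
  rw [← adjoint_B_apply, ← B_apply]
  rfl

/-- Every root `l` of the characteristic equation gives the radial eigenvector `J₀(l |x|)` for the
eigenvalue `i l`. -/
theorem exists_radial_eigenvector {l : ℂ}
    (hl : (Complex.I * l - l ^ 2) * besselJ 0 l + l * deriv (besselJ 0) l = 0) :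
    ∃ u : A.domain, IsEigenvector (Complex.I * l) u ∧
      IsRadial (u : H) (fun r => besselJ 0 (l * (r : ℂ))) := by
  have hs := contDiff_radialBessel l
  have m1 := memLp_disk hs.continuous
  have m2 := memLp_circle hs.continuous
  have m3 := memLp_disk (hs.continuous.const_mul (l ^ 2))
  have m4 := memLp_circle (continuous_const (y := radialSlope l 1))
  set U : H := WithLp.toLp 2 (m1.toLp _, m2.toLp _) with hU
  set F : H := WithLp.toLp 2 (m3.toLp _, m4.toLp _) with hF
  have hmem : (U, F) ∈ A.graph := by
    rw [A, Submodule.toLinearPMap_graph_eq _ stiffnessGraph_functional]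
    exact radialBessel_mem_stiffnessGraph l m1.coeFn_toLp m2.coeFn_toLp m3.coeFn_toLp m4.coeFn_toLp
  obtain ⟨u, huU, huF⟩ := (LinearPMap.mem_graph_iff _).1 hmem
  refine ⟨u, ⟨?_, ?_⟩, ?_⟩
  · -- `J₀(0) = 1`, so the function does not vanish near the origin
    rintro rfl
    have h0 : m1.toLp _ = 0 := congrArg WithLp.fst huU.symm
    have h1 : radialBessel l =ᵐ[volume.restrict disk] fun _ => 0 :=
      m1.coeFn_toLp.symm.trans (h0 ▸ Lp.coeFn_zero _ _ _)
    have h2 := Measure.eqOn_open_of_ae_eq h1 Metric.isOpen_ball hs.continuous.continuousOn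
      continuousOn_const (by simp : (0 : ℂ) ∈ disk)
    simp [radialBessel, reducedBessel_zero_zero] at h2
  · rw [pencil_apply, huU, huF]
    have hc : Complex.I * l * Complex.I * l = -l ^ 2 := by
      linear_combination l ^ 2 * Complex.I_sq
    refine WithLp.ofLp_injective 2 (Prod.ext ?_ ?_)
    · refine Lp.ext ?_
      change ⇑(m3.toLp _ + (Complex.I * l) • (0 : L2Disk) + (Complex.I * l) ^ 2 • m1.toLp _)
        =ᵐ[_] ⇑(0 : L2Disk)
      rw [smul_zero, add_zero]
      filter_upwards [Lp.coeFn_add (m3.toLp _) ((Complex.I * l) ^ 2 • m1.toLp _),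
        Lp.coeFn_smul ((Complex.I * l) ^ 2) (m1.toLp _), m3.coeFn_toLp, m1.coeFn_toLp,
        Lp.coeFn_zero ℂ 2 (volume.restrict disk)] with x h1 h2 h3 h4 h5
      rw [h1, Pi.add_apply, h2, Pi.smul_apply, h3, h4, h5, Pi.zero_apply, smul_eq_mul]
      linear_combination radialBessel l x * hc
    · refine Lp.ext ?_
      change ⇑(m4.toLp _ + (Complex.I * l) • m2.toLp _ + (Complex.I * l) ^ 2 • m2.toLp _)
        =ᵐ[_] ⇑(0 : L2Circle)
      filter_upwards [Lp.coeFn_add (m4.toLp _ + (Complex.I * l) • m2.toLp _)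
          ((Complex.I * l) ^ 2 • m2.toLp _),
        Lp.coeFn_add (m4.toLp _) ((Complex.I * l) • m2.toLp _),
        Lp.coeFn_smul (Complex.I * l) (m2.toLp _),
        Lp.coeFn_smul ((Complex.I * l) ^ 2) (m2.toLp _), m4.coeFn_toLp, m2.coeFn_toLp,
        Lp.coeFn_zero ℂ 2 arcLength, ae_arcLength] with x h1 h2 h3 h4 h5 h6 h7 h8
      rw [h1, Pi.add_apply, h2, Pi.add_apply, h3, h4, Pi.smul_apply, Pi.smul_apply, h5, h6, h7,
        Pi.zero_apply, smul_eq_mul, smul_eq_mul, radialBessel_eq, h8, radialSlope]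
      rw [deriv_besselJ_zero] at hl
      simp only [Complex.ofReal_one, mul_one, one_pow]
      linear_combination hl + besselJ 0 l * hc
  · rw [huU]
    refine ⟨m1.coeFn_toLp.trans (Eventually.of_forall fun x => radialBessel_eq l x),
      m2.coeFn_toLp.trans (Eventually.of_forall fun x => radialBessel_eq l x)⟩

/-! ### Bessel's integral and its deformation in the complex plane -/

theorem prod_wallis (m : ℕ) :
    ∏ i ∈ Finset.range m, (2 * (i : ℝ) + 1) / (2 * i + 2)
      = ((2 * m).factorial : ℝ) / (4 ^ m * (m.factorial : ℝ) ^ 2) := by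
  induction m with
  | zero => simp
  | succ m ih =>
    have h1 : (m.factorial : ℝ) ≠ 0 := by exact_mod_cast Nat.factorial_ne_zero _
    rw [Finset.prod_range_succ, ih, show 2 * (m + 1) = 2 * m + 1 + 1 by ring,
      Nat.factorial_succ, Nat.factorial_succ, Nat.factorial_succ]
    push_cast
    field_simp
    ring

/-- Bessel's integral for `J₀` on the real axis. -/
theorem integral_cos_mul_sin (x : ℝ) :
    ((∫ θ in (0 : ℝ)..Real.pi, Real.cos (x * Real.sin θ) : ℝ) : ℂ) = Real.pi * besselJ 0 x := by
  have hs : Summable fun n : ℕ => |x| ^ (2 * n) / ((2 * n).factorial : ℝ) :=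
    (Real.summable_pow_div_factorial |x|).comp_injective
      (fun a b (h : 2 * a = 2 * b) => by omega)
  have key := intervalIntegral.hasSum_integral_of_dominated_convergence (a := 0) (b := Real.pi)
    (μ := volume)
    (F := fun (n : ℕ) (θ : ℝ) => (-1) ^ n * (x * Real.sin θ) ^ (2 * n) / ((2 * n).factorial : ℝ))
    (f := fun θ => Real.cos (x * Real.sin θ))
    (fun n _ => |x| ^ (2 * n) / ((2 * n).factorial : ℝ))
    (fun n => (by fun_prop : Continuous _).aestronglyMeasurable)
    (fun n => Eventually.of_forall fun θ _ => by
      rw [norm_div, norm_mul, norm_pow, norm_neg, norm_one, one_pow, one_mul, norm_pow, norm_mul,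
        Real.norm_natCast, Real.norm_eq_abs, Real.norm_eq_abs]
      gcongr
      exact mul_le_of_le_one_right (abs_nonneg _) (Real.abs_sin_le_one θ))
    (Eventually.of_forall fun θ _ => hs) (continuous_const.intervalIntegrable _ _)
    (Eventually.of_forall fun θ _ => Real.hasSum_cos _)
  have hterm : ∀ n : ℕ, ∫ θ in (0 : ℝ)..Real.pi,
      (-1) ^ n * (x * Real.sin θ) ^ (2 * n) / ((2 * n).factorial : ℝ)
        = Real.pi * ((-1) ^ n / ((n.factorial : ℝ) * (n.factorial : ℝ)) * (x / 2) ^ (2 * n)) := by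
    intro n
    have h1 : (n.factorial : ℝ) ≠ 0 := by exact_mod_cast Nat.factorial_ne_zero _
    have h2 : ((2 * n).factorial : ℝ) ≠ 0 := by exact_mod_cast Nat.factorial_ne_zero _
    have e : (fun θ : ℝ => (-1) ^ n * (x * Real.sin θ) ^ (2 * n) / ((2 * n).factorial : ℝ))
        = fun θ => ((-1) ^ n * x ^ (2 * n) / ((2 * n).factorial : ℝ)) * Real.sin θ ^ (2 * n) := by
      funext θ
      rw [mul_pow]
      ring
    rw [e, intervalIntegral.integral_const_mul, integral_sin_pow_even, prod_wallis, div_pow,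
      pow_mul 2 2 n]
    norm_num
    field_simp
  simp only [hterm] at key
  have key2 := (Complex.hasSum_ofReal.2 key).tsum_eq
  rw [← key2, besselJ, ← tsum_mul_left]
  refine tsum_congr fun n => ?_
  simp

theorem integral_cos_mul_sin_symm (x : ℝ) :
    ∫ θ in (-(Real.pi / 2))..(Real.pi / 2), Real.cos (x * Real.sin θ)
      = ∫ θ in (0 : ℝ)..Real.pi, Real.cos (x * Real.sin θ) := by
  have hp : Function.Periodic (fun θ => Real.cos (x * Real.sin θ)) Real.pi := fun θ => by
    simp [Real.sin_add_pi]
  have := hp.intervalIntegral_add_eq (-(Real.pi / 2)) 0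
  rw [zero_add] at this
  rw [← this]
  congr 1
  ring

theorem norm_cpow_neg_half (ζ : ℂ) : ‖ζ ^ (-1 / 2 : ℂ)‖ = ‖ζ‖ ^ (-1 / 2 : ℝ) := by
  have : (-1 / 2 : ℂ) = ((-1 / 2 : ℝ) : ℂ) := by push_cast; rfl
  rw [this, Complex.norm_cpow_real]

/-- The integrand `e^{ixt} (1 - t²)^{-1/2}` of Bessel's integral in the variable `t = sin θ`. -/
noncomputable def besselKernel (x : ℝ) (t : ℂ) : ℂ :=
  Complex.exp (Complex.I * x * t) * (1 - t ^ 2) ^ (-1 / 2 : ℂ)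

theorem one_sub_sq_re (t : ℂ) : (1 - t ^ 2).re = 1 - t.re ^ 2 + t.im ^ 2 := by
  simp [pow_two]
  ring

theorem differentiableAt_besselKernel (x : ℝ) {t : ℂ} (ht : 1 - t ^ 2 ∈ Complex.slitPlane) :
    DifferentiableAt ℂ (besselKernel x) t := by
  have h1 : DifferentiableAt ℂ (fun t : ℂ => 1 - t ^ 2) t := by fun_prop
  have h2 : DifferentiableAt ℂ (fun t : ℂ => Complex.exp (Complex.I * x * t)) t := by fun_prop
  exact h2.mul (h1.cpow_const ht)

theorem one_sub_sq_mem_slitPlane {t : ℂ} (ht : |t.re| < 1) : 1 - t ^ 2 ∈ Complex.slitPlane := by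
  left
  rw [one_sub_sq_re]
  have := (sq_lt_one_iff_abs_lt_one t.re).2 ht
  nlinarith [sq_nonneg t.im]

theorem norm_exp_I_mul (x : ℝ) (t : ℂ) :
    ‖Complex.exp (Complex.I * x * t)‖ = Real.exp (-x * t.im) := by
  rw [Complex.norm_exp]
  simp

theorem besselKernel_neg_conj (x : ℝ) {t : ℂ} (ht : |t.re| < 1) :
    besselKernel x (-conj t) = conj (besselKernel x t) := by
  have h1 : (1 - t ^ 2).arg ≠ Real.pi :=
    Complex.slitPlane_arg_ne_pi (one_sub_sq_mem_slitPlane ht)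
  have h2 : 1 - (-conj t) ^ 2 = conj (1 - t ^ 2) := by simp
  have h3 : conj (-1 / 2 : ℂ) = -1 / 2 := by
    rw [map_div₀, map_neg, map_one, map_ofNat]
  rw [besselKernel, besselKernel, h2, Complex.conj_cpow _ _ h1, h3, map_mul, ← Complex.exp_conj]
  simp

/-- On vertical lines the kernel is dominated by an integrable function, uniformly up to the branch
points. -/
theorem norm_besselKernel_le (x : ℝ) {a s : ℝ} (ha : 0 ≤ a) (hs : 0 < s) :
    ‖besselKernel x (a + s * Complex.I)‖ ≤ s ^ (-1 / 2 : ℝ) * Real.exp (-x * s) := by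
  have h1 : s ≤ ‖1 - ((a : ℂ) + s * Complex.I) ^ 2‖ := by
    have e : 1 - ((a : ℂ) + s * Complex.I) ^ 2
        = (1 - (a + s * Complex.I)) * (1 + (a + s * Complex.I)) := by ring
    have k1 := Complex.abs_im_le_norm (1 - ((a : ℂ) + s * Complex.I))
    have k2 := Complex.re_le_norm (1 + ((a : ℂ) + s * Complex.I))
    simp at k1 k2
    rw [abs_of_pos hs] at k1
    rw [e, norm_mul]
    nlinarith
  rw [besselKernel, norm_mul, norm_exp_I_mul, norm_cpow_neg_half, mul_comm]
  have e2 : ((a : ℂ) + s * Complex.I).im = s := by simp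
  rw [e2]
  gcongr ?_ * _
  exact Real.rpow_le_rpow_of_nonpos hs h1 (by norm_num)

theorem integrableOn_besselKernel_bound {x : ℝ} (hx : 0 < x) :
    IntegrableOn (fun s : ℝ => s ^ (-1 / 2 : ℝ) * Real.exp (-x * s)) (Set.Ioi 0) := by
  simpa using integrableOn_rpow_mul_exp_neg_mul_rpow (p := 1) (s := -1 / 2) (b := x)
    (by norm_num) one_pos hx

theorem measurable_besselKernel_vertical (x a : ℝ) :
    Measurable fun s : ℝ => besselKernel x (a + s * Complex.I) := by
  unfold besselKernel
  fun_prop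

theorem integrableOn_besselKernel_vertical {x a : ℝ} (hx : 0 < x) (ha : 0 ≤ a) :
    IntegrableOn (fun s : ℝ => besselKernel x (a + s * Complex.I)) (Set.Ioi 0) := by
  refine (integrableOn_besselKernel_bound hx).mono'
    (measurable_besselKernel_vertical x a).aestronglyMeasurable ?_
  filter_upwards [ae_restrict_mem measurableSet_Ioi] with s hs
  exact norm_besselKernel_le x ha hs

/-- Cauchy's theorem on the half-strip above `[-a, a]`. -/
theorem integral_besselKernel_segment {x a : ℝ} (hx : 0 < x) (ha : 0 ≤ a) (ha1 : a < 1) :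
    ∫ t in (-a)..a, besselKernel x (t : ℂ)
      = ((2 * (∫ s in Set.Ioi (0 : ℝ), besselKernel x (a + s * Complex.I)).im : ℝ) : ℂ) := by
  set S : ℂ := ∫ s in Set.Ioi (0 : ℝ), besselKernel x (a + s * Complex.I) with hS
  have hleft : ∀ s : ℝ, besselKernel x (((-a : ℝ) : ℂ) + s * Complex.I)
      = conj (besselKernel x (a + s * Complex.I)) := by
    intro s
    rw [← besselKernel_neg_conj x (by simpa [abs_of_nonneg ha] using ha1)]
    congr 1
    simp [add_comm]
  have hrect : ∀ R : ℝ, 0 < R →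
      (∫ t in (-a)..a, besselKernel x (t : ℂ))
        - (∫ t in (-a)..a, besselKernel x ((t : ℂ) + R * Complex.I))
        + Complex.I • (∫ s in (0 : ℝ)..R, besselKernel x (a + s * Complex.I))
        - Complex.I • (∫ s in (0 : ℝ)..R, conj (besselKernel x (a + s * Complex.I))) = 0 := by
    intro R hR
    have h := Complex.integral_boundary_rect_eq_zero_of_differentiableOn (besselKernel x)
      ((-a : ℝ) : ℂ) ((a : ℂ) + R * Complex.I) ?_
    · simp at h
      simpa [← hleft] using h
    · intro t ht
      have h1 : t.re ∈ Set.uIcc (-a) a := by simpa using ht.1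
      rw [Set.uIcc_of_le (by linarith)] at h1
      refine (differentiableAt_besselKernel x (one_sub_sq_mem_slitPlane ?_)).differentiableWithinAt
      rw [abs_lt]
      exact ⟨by linarith [h1.1], by linarith [h1.2]⟩
  have hint := integrableOn_besselKernel_vertical hx ha
  have hright : Tendsto (fun R : ℝ => ∫ s in (0 : ℝ)..R, besselKernel x (a + s * Complex.I))
      atTop (𝓝 S) := intervalIntegral_tendsto_integral_Ioi 0 hint tendsto_id
  have hleft' : Tendsto (fun R : ℝ => ∫ s in (0 : ℝ)..R, conj (besselKernel x (a + s * Complex.I)))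
      atTop (𝓝 (conj S)) := by
    rw [hS, ← integral_conj]
    exact intervalIntegral_tendsto_integral_Ioi 0
      (Complex.conjCLE.toContinuousLinearMap.integrable_comp hint) tendsto_id
  have htop : Tendsto (fun R : ℝ => ∫ t in (-a)..a, besselKernel x ((t : ℂ) + R * Complex.I))
      atTop (𝓝 0) := by
    have hb : Tendsto (fun R : ℝ => Real.exp (-x * R) * |a - -a|) atTop (𝓝 0) := by
      have : Tendsto (fun R : ℝ => Real.exp (-x * R)) atTop (𝓝 0) :=
        Real.tendsto_exp_atBot.comp (tendsto_id.const_mul_atTop_of_neg (by linarith))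
      simpa using this.mul_const |a - -a|
    refine squeeze_zero_norm' ?_ hb
    filter_upwards [eventually_ge_atTop 1] with R hR
    refine intervalIntegral.norm_integral_le_of_norm_le_const fun t ht => ?_
    rw [Set.uIoc_of_le (by linarith)] at ht
    have e1 : ((t : ℂ) + R * Complex.I).im = R := by simp
    have e2 : ((t : ℂ) + R * Complex.I).re = t := by simp
    have h1 : 1 ≤ ‖1 - ((t : ℂ) + R * Complex.I) ^ 2‖ := by
      refine le_trans ?_ (Complex.re_le_norm _)
      rw [one_sub_sq_re, e1, e2]
      nlinarith [ht.1, ht.2]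
    rw [besselKernel, norm_mul, norm_exp_I_mul, norm_cpow_neg_half, e1]
    exact mul_le_of_le_one_right (Real.exp_pos _).le
      (Real.rpow_le_one_of_one_le_of_nonpos h1 (by norm_num))
  have hlim := ((tendsto_const_nhds (x := ∫ t in (-a)..a, besselKernel x (t : ℂ))).sub
    htop).add (hright.const_smul Complex.I) |>.sub (hleft'.const_smul Complex.I)
  have h0 := tendsto_nhds_unique hlim ((tendsto_congr' (by
    filter_upwards [eventually_gt_atTop 0] with R hR
    exact hrect R hR)).2 tendsto_const_nhds)
  rw [sub_zero, smul_eq_mul, smul_eq_mul] at h0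
  have h2 : S - conj S = 2 * S.im * Complex.I := by
    rw [Complex.sub_conj]
    push_cast
    ring
  push_cast
  linear_combination h0 - Complex.I * h2 - 2 * (S.im : ℂ) * Complex.I_sq

theorem integral_besselKernel_eq_integral_sin (x : ℝ) {α : ℝ} (h0 : 0 ≤ α) (h1 : α < Real.pi / 2) :
    ∫ t in (-Real.sin α)..(Real.sin α), besselKernel x (t : ℂ)
      = ∫ θ in (-α)..α, Complex.exp (Complex.I * x * Real.sin θ) := by
  have hcos : ∀ θ ∈ Set.uIcc (-α) α, 0 < Real.cos θ := fun θ hθ => by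
    rw [Set.uIcc_of_le (by linarith)] at hθ
    exact Real.cos_pos_of_mem_Ioo ⟨by linarith [hθ.1], by linarith [hθ.2]⟩
  have := intervalIntegral.integral_deriv_smul_comp' (a := -α) (b := α) (f := Real.sin)
    (f' := Real.cos) (g := fun t : ℝ => besselKernel x (t : ℂ))
    (fun θ _ => Real.hasDerivAt_sin θ) Real.continuous_cos.continuousOn ?_
  · rw [Real.sin_neg] at this
    rw [← this]
    refine intervalIntegral.integral_congr fun θ hθ => ?_
    have hc := hcos θ hθ
    have e : (1 : ℂ) - (Real.sin θ : ℂ) ^ 2 = ((Real.cos θ ^ 2 : ℝ) : ℂ) := by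
      rw [Real.cos_sq']
      push_cast
      rfl
    have e2 : (-1 / 2 : ℂ) = ((-1 / 2 : ℝ) : ℂ) := by push_cast; rfl
    have e3 : (Real.cos θ ^ 2) ^ (-1 / 2 : ℝ) = (Real.cos θ)⁻¹ := by
      rw [← Real.rpow_natCast, ← Real.rpow_mul hc.le, ← Real.rpow_neg_one]
      norm_num
    have hc' : (Real.cos θ : ℂ) ≠ 0 := by exact_mod_cast hc.ne'
    simp only [Function.comp, besselKernel]
    rw [e, e2, ← Complex.ofReal_cpow (by positivity), e3, Complex.real_smul, Complex.ofReal_inv]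
    field_simp
  · rintro _ ⟨θ, hθ, rfl⟩
    have hc := hcos θ hθ
    have hlt : |((Real.sin θ : ℝ) : ℂ).re| < 1 := by
      rw [Complex.ofReal_re, ← sq_lt_one_iff_abs_lt_one, Real.sin_sq]
      nlinarith
    exact ((differentiableAt_besselKernel x (one_sub_sq_mem_slitPlane hlt)).continuousAt.comp
      (f := fun t : ℝ => (t : ℂ)) Complex.continuous_ofReal.continuousAt).continuousWithinAt

/-- Deforming Bessel's integral to the vertical half-lines above `±1` turns its oscillation into
exponential decay. -/
theorem pi_mul_besselJ_zero {x : ℝ} (hx : 0 < x) :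
    (Real.pi : ℂ) * besselJ 0 x
      = ((2 * (∫ s in Set.Ioi (0 : ℝ), besselKernel x (1 + s * Complex.I)).im : ℝ) : ℂ) := by
  have hcont : Continuous fun θ : ℝ => Complex.exp (Complex.I * x * Real.sin θ) := by fun_prop
  have hl : Tendsto (fun α : ℝ => ∫ θ in (-α)..α, Complex.exp (Complex.I * x * Real.sin θ))
      (𝓝[<] (Real.pi / 2))
      (𝓝 (∫ θ in (-(Real.pi / 2))..(Real.pi / 2), Complex.exp (Complex.I * x * Real.sin θ))) := by
    have h := intervalIntegral.continuous_primitive (μ := volume)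
      (fun a b => hcont.intervalIntegrable a b) 0
    have e : (fun α : ℝ => ∫ θ in (-α)..α, Complex.exp (Complex.I * x * Real.sin θ))
        = fun α => (∫ θ in (0 : ℝ)..α, Complex.exp (Complex.I * x * Real.sin θ))
          - ∫ θ in (0 : ℝ)..(-α), Complex.exp (Complex.I * x * Real.sin θ) := by
      funext α
      rw [intervalIntegral.integral_interval_sub_left] <;> exact hcont.intervalIntegrable _ _
    have hc : Continuous fun α : ℝ =>
        ∫ θ in (-α)..α, Complex.exp (Complex.I * x * Real.sin θ) := by
      rw [e]
      exact h.sub (h.comp continuous_neg)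
    exact hc.continuousAt.tendsto.mono_left nhdsWithin_le_nhds
  have hr : Tendsto (fun α : ℝ => ∫ s in Set.Ioi (0 : ℝ),
        besselKernel x ((Real.sin α : ℝ) + s * Complex.I)) (𝓝[<] (Real.pi / 2))
      (𝓝 (∫ s in Set.Ioi (0 : ℝ), besselKernel x (1 + s * Complex.I))) := by
    refine tendsto_integral_filter_of_dominated_convergence _ ?_ ?_
      (integrableOn_besselKernel_bound hx) ?_
    · exact Eventually.of_forall fun α =>
        (measurable_besselKernel_vertical x _).aestronglyMeasurable
    · filter_upwards [Ioo_mem_nhdsLT (by positivity : (0 : ℝ) < Real.pi / 2)] with α hα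
      filter_upwards [ae_restrict_mem measurableSet_Ioi] with s hs
      exact norm_besselKernel_le x
        (Real.sin_nonneg_of_nonneg_of_le_pi hα.1.le (by linarith [hα.2, Real.pi_pos])) hs
    · filter_upwards [ae_restrict_mem measurableSet_Ioi] with s hs
      have hs' : (0 : ℝ) < s := hs
      have hslit : 1 - (1 + s * Complex.I) ^ 2 ∈ Complex.slitPlane := by
        right
        simp [pow_two]
        linarith
      have h1 := (differentiableAt_besselKernel x hslit).continuousAt
      have h2 : Tendsto (fun α : ℝ => ((Real.sin α : ℝ) : ℂ) + s * Complex.I) (𝓝[<] (Real.pi / 2))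
          (𝓝 (1 + s * Complex.I)) := by
        have hc : Continuous fun α : ℝ => ((Real.sin α : ℝ) : ℂ) + s * Complex.I := by fun_prop
        have := (hc.tendsto (Real.pi / 2)).mono_left
          (nhdsWithin_le_nhds (s := Set.Iio (Real.pi / 2)))
        simpa using this
      exact h1.tendsto.comp h2
  have him : Continuous fun z : ℂ => ((2 * z.im : ℝ) : ℂ) :=
    Complex.continuous_ofReal.comp (continuous_const.mul Complex.continuous_im)
  have hr' := (him.tendsto _).comp hr
  have heq := tendsto_nhds_unique (hl.congr' ?_) hr'
  · rw [← integral_cos_mul_sin, ← integral_cos_mul_sin_symm]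
    have hre := congrArg Complex.re heq
    rw [Complex.ofReal_re] at hre
    have h := intervalIntegral.intervalIntegral_re (𝕜 := ℂ)
      (hcont.intervalIntegrable (μ := volume) (-(Real.pi / 2)) (Real.pi / 2))
    rw [← hre]
    congr 1
    refine Eq.trans (intervalIntegral.integral_congr fun θ _ => ?_) h
    have e : Complex.I * x * Real.sin θ = ((x * Real.sin θ : ℝ) : ℂ) * Complex.I := by
      push_cast
      ring
    simp only [e]
    exact (Complex.exp_ofReal_mul_I_re _).symm
  · filter_upwards [Ioo_mem_nhdsLT (by positivity : (0 : ℝ) < Real.pi / 2)] with α hα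
    have h1 : Real.sin α < 1 := by
      rw [← Real.sin_pi_div_two]
      exact Real.sin_lt_sin_of_lt_of_le_pi_div_two (by linarith [hα.1, Real.pi_pos]) le_rfl hα.2
    rw [← integral_besselKernel_eq_integral_sin x hα.1.le hα.2, integral_besselKernel_segment hx
      (Real.sin_nonneg_of_nonneg_of_le_pi hα.1.le (by linarith [hα.2, Real.pi_pos])) h1]
    rfl

/-! ### Asymptotic expansion of `J₀` on the real axis -/

/-- Second-order Taylor expansion of `(1 + i s / 2)^{-1/2}`, with a remainder that is cubic on the
whole half-line. -/
theorem norm_cpow_neg_half_sub_taylor_le {s : ℝ} (hs : 0 < s) :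
    ‖(1 + Complex.I * s / 2) ^ (-1 / 2 : ℂ) - (1 - Complex.I * s / 4 - 3 * (s : ℂ) ^ 2 / 32)‖
      ≤ s ^ 3 := by
  set ζ : ℂ := Complex.I * s / 2 with hζ
  set p : ℂ := (1 + ζ) ^ (-1 / 2 : ℂ) with hp
  set T : ℂ := 1 - Complex.I * s / 4 - 3 * (s : ℂ) ^ 2 / 32 with hT
  have hre : (1 + ζ).re = 1 := by simp [hζ]
  have hn1 : 1 ≤ ‖1 + ζ‖ := by simpa [hre] using Complex.re_le_norm (1 + ζ)
  have hne : 1 + ζ ≠ 0 := norm_pos_iff.1 (by linarith)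
  have hζn : ‖ζ‖ = s / 2 := by
    rw [hζ, norm_div, norm_mul, Complex.norm_I, Complex.norm_real, Real.norm_of_nonneg hs.le]
    norm_num
  have hTζ : T = 1 - ζ / 2 + 3 * ζ ^ 2 / 8 := by
    rw [hT, hζ]
    linear_combination (-3 * (s : ℂ) ^ 2 / 32) * Complex.I_sq
  have hpn : ‖p‖ ≤ 1 := by
    rw [hp, norm_cpow_neg_half]
    exact Real.rpow_le_one_of_one_le_of_nonpos hn1 (by norm_num)
  rcases le_or_gt s 2 with h2 | h2
  · -- both `p` and `T` are approximate square roots of `1 / (1 + ζ)` with positive real part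
    have hsq : p ^ 2 * (1 + ζ) = 1 := by
      have e : p ^ 2 = (1 + ζ)⁻¹ := by
        rw [hp, ← Complex.cpow_nat_mul, ← Complex.cpow_neg_one]
        norm_num
      rw [e, inv_mul_cancel₀ hne]
    have hpre : 0 ≤ p.re := by
      have harg := Complex.abs_arg_lt_pi_div_two_iff.2 (Or.inl (by rw [hre]; exact one_pos))
      rw [hp, Complex.cpow_def_of_ne_zero hne, Complex.exp_re]
      refine mul_nonneg (Real.exp_pos _).le (Real.cos_nonneg_of_mem_Icc ?_)
      have e : (Complex.log (1 + ζ) * (-1 / 2)).im = -(Complex.arg (1 + ζ)) / 2 := by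
        have : (-1 / 2 : ℂ) = ((-1 / 2 : ℝ) : ℂ) := by push_cast; rfl
        rw [this, Complex.im_mul_ofReal, Complex.log_im]
        ring
      rw [e]
      rw [abs_lt] at harg
      constructor <;> linarith [harg.1, harg.2, Real.pi_pos]
    have hTre : T.re = 1 - 3 * s ^ 2 / 32 := by
      rw [hT]
      norm_cast
      simp [pow_two]
    have hsum : 5 / 8 ≤ ‖p + T‖ := by
      refine le_trans ?_ (Complex.re_le_norm _)
      rw [Complex.add_re, hTre]
      nlinarith
    have hid : (p - T) * (p + T) * (1 + ζ) = -(ζ ^ 3 * (5 / 8 - 15 / 64 * ζ + 9 / 64 * ζ ^ 2)) := by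
      rw [hTζ]
      linear_combination hsq
    have hlow : ‖p - T‖ * (5 / 8) ≤ ‖(p - T) * (p + T) * (1 + ζ)‖ := by
      rw [norm_mul, norm_mul]
      calc ‖p - T‖ * (5 / 8) = ‖p - T‖ * (5 / 8) * 1 := (mul_one _).symm
        _ ≤ _ := by gcongr
    have hup : ‖(p - T) * (p + T) * (1 + ζ)‖ ≤ (s / 2) ^ 3 * 1 := by
      rw [hid, norm_neg, norm_mul, norm_pow, hζn]
      gcongr
      have h1 : ‖(5 / 8 : ℂ) - 15 / 64 * ζ + 9 / 64 * ζ ^ 2‖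
          ≤ ‖(5 / 8 : ℂ)‖ + ‖(15 / 64 : ℂ) * ζ‖ + ‖(9 / 64 : ℂ) * ζ ^ 2‖ :=
        (norm_add_le _ _).trans (add_le_add_left (norm_sub_le _ _) _)
      rw [norm_mul, norm_mul, norm_pow, hζn] at h1
      norm_num at h1
      nlinarith
    nlinarith [pow_pos hs 3]
  · have hTn : ‖T‖ ≤ 1 + s / 4 + 3 * s ^ 2 / 32 := by
      have h1 : ‖T‖ ≤ ‖(1 : ℂ)‖ + ‖Complex.I * s / 4‖ + ‖3 * (s : ℂ) ^ 2 / 32‖ :=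
        (norm_sub_le _ _).trans (add_le_add_left (norm_sub_le _ _) _)
      rw [norm_div, norm_div, norm_mul, norm_mul, norm_pow, Complex.norm_I, Complex.norm_real,
        Real.norm_of_nonneg hs.le] at h1
      norm_num at h1
      linarith
    have h3 : 4 * s ≤ s ^ 3 := by nlinarith
    have h4 : 2 * s ^ 2 ≤ s ^ 3 := by nlinarith
    have := norm_sub_le p T
    linarith

theorem one_sub_sq_cpow {s : ℝ} (hs : 0 < s) :
    (1 - (1 + s * Complex.I) ^ 2) ^ (-1 / 2 : ℂ)
      = ((2 ^ (-1 / 2 : ℝ) * s ^ (-1 / 2 : ℝ) : ℝ) : ℂ)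
        * Complex.exp (Complex.I * (Real.pi / 4 : ℝ)) * (1 + Complex.I * s / 2) ^ (-1 / 2 : ℂ) := by
  set q : ℂ := 1 + Complex.I * s / 2 with hq
  have hre : q.re = 1 := by simp [hq]
  have hq0 : q ≠ 0 := fun h => by simp [h] at hre
  have harg := Complex.abs_arg_lt_pi_div_two_iff.2 (Or.inl (by rw [hre]; exact one_pos))
  rw [abs_lt] at harg
  have hI : (-Complex.I) ≠ 0 := by simp
  have e1 : 1 - (1 + s * Complex.I) ^ 2 = ((2 * s : ℝ) : ℂ) * (-Complex.I * q) := by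
    rw [hq]
    push_cast
    linear_combination (-(s : ℂ) ^ 2 + s ^ 2) * Complex.I_sq
  have h2s : (0 : ℝ) < 2 * s := by positivity
  have hlog : Complex.log (1 - (1 + s * Complex.I) ^ 2)
      = Real.log (2 * s) + (-(Real.pi / 2) * Complex.I + Complex.log q) := by
    rw [e1, Complex.log_ofReal_mul h2s (mul_ne_zero hI hq0), Complex.log_mul hI hq0,
      Complex.log_neg_I]
    rw [Complex.arg_neg_I]
    constructor <;> linarith [harg.1, harg.2, Real.pi_pos]
  have hne : 1 - (1 + s * Complex.I) ^ 2 ≠ 0 := by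
    rw [e1]
    exact mul_ne_zero (by exact_mod_cast h2s.ne') (mul_ne_zero hI hq0)
  rw [← Real.mul_rpow zero_le_two hs.le, Real.rpow_def_of_pos h2s,
    Complex.cpow_def_of_ne_zero hne, hlog, Complex.cpow_def_of_ne_zero hq0, Complex.ofReal_exp,
    ← Complex.exp_add, ← Complex.exp_add]
  congr 1
  push_cast
  ring

/-- The integrals in Watson's lemma. -/
theorem integral_watson_moment {x : ℝ} (hx : 0 < x) (n : ℕ) :
    IntegrableOn (fun s : ℝ => s ^ (-1 / 2 : ℝ) * Real.exp (-x * s) * s ^ n) (Set.Ioi 0) ∧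
      ∫ s in Set.Ioi (0 : ℝ), s ^ (-1 / 2 : ℝ) * Real.exp (-x * s) * s ^ n
        = (1 / x) ^ ((n : ℝ) + 1 / 2) * Real.Gamma ((n : ℝ) + 1 / 2) := by
  have hn : (0 : ℝ) ≤ n := Nat.cast_nonneg n
  have e : Set.EqOn (fun s : ℝ => s ^ (-1 / 2 : ℝ) * Real.exp (-x * s) * s ^ n)
      (fun s : ℝ => s ^ (((n : ℝ) + 1 / 2) - 1) * Real.exp (-(x * s))) (Set.Ioi 0) := by
    intro s hs
    have hs' : (0 : ℝ) < s := hs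
    have : ((n : ℝ) + 1 / 2) - 1 = -1 / 2 + n := by ring
    simp only
    rw [this, Real.rpow_add hs', Real.rpow_natCast, neg_mul]
    ring
  constructor
  · rw [integrableOn_congr_fun e measurableSet_Ioi]
    simpa using integrableOn_rpow_mul_exp_neg_mul_rpow (p := 1) (s := ((n : ℝ) + 1 / 2) - 1)
      (b := x) (by linarith) one_pos hx
  · rw [setIntegral_congr_fun measurableSet_Ioi e,
      Real.integral_rpow_mul_exp_neg_mul_Ioi (by linarith) hx]

theorem watson_moment_succ {x : ℝ} (hx : 0 < x) (n : ℕ) :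
    (1 / x) ^ (((n + 1 : ℕ) : ℝ) + 1 / 2) * Real.Gamma (((n + 1 : ℕ) : ℝ) + 1 / 2)
      = ((n : ℝ) + 1 / 2) / x
        * ((1 / x) ^ ((n : ℝ) + 1 / 2) * Real.Gamma ((n : ℝ) + 1 / 2)) := by
  have hn : (0 : ℝ) ≤ n := Nat.cast_nonneg n
  have e : ((n + 1 : ℕ) : ℝ) + 1 / 2 = ((n : ℝ) + 1 / 2) + 1 := by
    push_cast
    ring
  rw [e, Real.Gamma_add_one (by linarith), Real.rpow_add_one (by positivity)]
  field_simp

/-- Hankel's expansion of `J₀` on the positive real axis, with an error of relative size `x⁻³`. -/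
theorem besselJ_zero_hankel {x : ℝ} (hx : 0 < x) : ∃ c e : ℝ, 0 < c ∧ |e| ≤ 15 / 8 / x ^ 3 ∧
    besselJ 0 x = ((c * (Real.sin (x + Real.pi / 4) * (1 - 9 / (128 * x ^ 2))
      - Real.cos (x + Real.pi / 4) / (8 * x) + e) : ℝ) : ℂ) := by
  set w : ℝ → ℝ := fun s => s ^ (-1 / 2 : ℝ) * Real.exp (-x * s) with hw
  set p : ℝ → ℂ := fun s => (1 + Complex.I * s / 2) ^ (-1 / 2 : ℂ) with hp
  set E : ℂ := Complex.exp (Complex.I * (x + Real.pi / 4 : ℝ)) with hE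
  set K : ℝ := 2 ^ (-1 / 2 : ℝ) with hK
  have hK0 : 0 < K := Real.rpow_pos_of_pos two_pos _
  set μ : ℝ := (1 / x) ^ (1 / 2 : ℝ) * Real.Gamma (1 / 2) with hμ
  have hμ0 : 0 < μ := mul_pos (Real.rpow_pos_of_pos (by positivity) _)
    (Real.Gamma_pos_of_pos (by norm_num))
  -- the moments of the weight
  have hm0 : ∫ s in Set.Ioi (0 : ℝ), w s * s ^ 0 = μ := by
    rw [(integral_watson_moment hx 0).2, hμ]
    simp
  have hms : ∀ n : ℕ, ∫ s in Set.Ioi (0 : ℝ), w s * s ^ (n + 1)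
      = ((n : ℝ) + 1 / 2) / x * ∫ s in Set.Ioi (0 : ℝ), w s * s ^ n := by
    intro n
    rw [(integral_watson_moment hx (n + 1)).2, (integral_watson_moment hx n).2,
      watson_moment_succ hx n]
  have hm1 := hms 0
  have hm2 := hms 1
  have hm3 := hms 2
  rw [zero_add, hm0] at hm1
  rw [one_add_one_eq_two, hm1] at hm2
  rw [hm2] at hm3
  norm_num at hm3
  have hi : ∀ n : ℕ, IntegrableOn (fun s : ℝ => ((w s * s ^ n : ℝ) : ℂ)) (Set.Ioi 0) := fun n =>
    (integral_watson_moment hx n).1.ofReal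
  have hker : ∀ s ∈ Set.Ioi (0 : ℝ), besselKernel x (1 + s * Complex.I)
      = E * K * (w s * p s) := by
    intro s hs
    have e1 : Complex.I * x * (1 + s * Complex.I) = Complex.I * x + ((-x * s : ℝ) : ℂ) := by
      push_cast
      linear_combination (x * s : ℂ) * Complex.I_sq
    have e2 : E = Complex.exp (Complex.I * x) * Complex.exp (Complex.I * (Real.pi / 4 : ℝ)) := by
      rw [hE, ← Complex.exp_add]
      congr 1
      push_cast
      ring
    rw [besselKernel, one_sub_sq_cpow hs, e1, Complex.exp_add, e2]
    simp only [hw, hp]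
    push_cast
    ring
  have hpm : Measurable p := by
    simp only [hp]
    fun_prop
  have hwm : Measurable w := by
    simp only [hw]
    fun_prop
  have hip : IntegrableOn (fun s : ℝ => (w s : ℂ) * p s) (Set.Ioi 0) := by
    refine (integral_watson_moment hx 0).1.mono'
      ((Complex.measurable_ofReal.comp hwm).mul hpm).aestronglyMeasurable ?_
    filter_upwards [ae_restrict_mem measurableSet_Ioi] with s hs
    have hs' : (0 : ℝ) < s := hs
    have hw0 : 0 ≤ w s := by positivity
    have h1 : ‖p s‖ ≤ 1 := by
      rw [hp, norm_cpow_neg_half]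
      refine Real.rpow_le_one_of_one_le_of_nonpos ?_ (by norm_num)
      simpa using Complex.re_le_norm (1 + Complex.I * s / 2)
    rw [norm_mul, Complex.norm_real, Real.norm_of_nonneg hw0, pow_zero]
    gcongr
  -- Watson's lemma
  set D : ℂ := (∫ s in Set.Ioi (0 : ℝ), (w s : ℂ) * p s)
    - μ * (1 - Complex.I / (8 * x) - 9 / (128 * x ^ 2)) with hD
  have hDle : ‖D‖ ≤ 15 / 8 / x ^ 3 * μ := by
    have hDint : D = ∫ s in Set.Ioi (0 : ℝ), (w s : ℂ)
        * (p s - (1 - Complex.I * s / 4 - 3 * (s : ℂ) ^ 2 / 32)) := by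
      have e : ∀ s : ℝ, (w s : ℂ) * (p s - (1 - Complex.I * s / 4 - 3 * (s : ℂ) ^ 2 / 32))
          = (w s : ℂ) * p s - (((w s * s ^ 0 : ℝ) : ℂ) - Complex.I / 4 * ((w s * s ^ 1 : ℝ) : ℂ)
            - 3 / 32 * ((w s * s ^ 2 : ℝ) : ℂ)) := by
        intro s
        push_cast
        ring
      have i1 : IntegrableOn (fun s : ℝ => Complex.I / 4 * ((w s * s ^ 1 : ℝ) : ℂ)) (Set.Ioi 0) :=
        (hi 1).const_mul _
      have i2 : IntegrableOn (fun s : ℝ => 3 / 32 * ((w s * s ^ 2 : ℝ) : ℂ)) (Set.Ioi 0) :=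
        (hi 2).const_mul _
      have i3 : IntegrableOn (fun s : ℝ => ((w s * s ^ 0 : ℝ) : ℂ)
          - Complex.I / 4 * ((w s * s ^ 1 : ℝ) : ℂ)) (Set.Ioi 0) := (hi 0).sub i1
      have i4 : IntegrableOn (fun s : ℝ => ((w s * s ^ 0 : ℝ) : ℂ)
          - Complex.I / 4 * ((w s * s ^ 1 : ℝ) : ℂ) - 3 / 32 * ((w s * s ^ 2 : ℝ) : ℂ))
          (Set.Ioi 0) := i3.sub i2
      simp only [e]
      rw [integral_sub hip i4, integral_sub i3 i2, integral_sub (hi 0) i1, integral_const_mul,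
        integral_const_mul, integral_complex_ofReal, integral_complex_ofReal,
        integral_complex_ofReal, hm0, hm1, hm2, hD]
      have hxc : (x : ℂ) ≠ 0 := by exact_mod_cast hx.ne'
      push_cast
      field_simp
      ring
    rw [hDint]
    have h3 : 15 / 8 / x ^ 3 * μ = ∫ s in Set.Ioi (0 : ℝ), w s * s ^ 3 := by
      rw [hm3]
      field_simp
      norm_num
    rw [h3]
    refine norm_integral_le_of_norm_le (integral_watson_moment hx 3).1 ?_
    filter_upwards [ae_restrict_mem measurableSet_Ioi] with s hs
    have hs' : (0 : ℝ) < s := hs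
    have hw0 : 0 ≤ w s := by positivity
    rw [norm_mul, Complex.norm_real, Real.norm_of_nonneg hw0]
    exact mul_le_mul_of_nonneg_left (norm_cpow_neg_half_sub_taylor_le hs) hw0
  have hS : ∫ s in Set.Ioi (0 : ℝ), besselKernel x (1 + s * Complex.I)
      = E * K * (D + μ * (1 - Complex.I / (8 * x) - 9 / (128 * x ^ 2))) := by
    rw [setIntegral_congr_fun measurableSet_Ioi hker, integral_const_mul, hD]
    ring
  have hEn : ‖E‖ = 1 := by
    rw [hE, mul_comm]
    exact Complex.norm_exp_ofReal_mul_I _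
  have hEre : E.re = Real.cos (x + Real.pi / 4) := by
    rw [hE, mul_comm]
    exact Complex.exp_ofReal_mul_I_re _
  have hEim : E.im = Real.sin (x + Real.pi / 4) := by
    rw [hE, mul_comm]
    exact Complex.exp_ofReal_mul_I_im _
  refine ⟨2 * K * μ / Real.pi, (E * D).im / μ, by positivity, ?_, ?_⟩
  · rw [abs_div, abs_of_pos hμ0, div_le_iff₀ hμ0]
    refine (Complex.abs_im_le_norm _).trans ?_
    rwa [norm_mul, hEn, one_mul]
  · have hpi : (Real.pi : ℂ) ≠ 0 := by exact_mod_cast Real.pi_pos.ne'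
    refine mul_left_cancel₀ hpi ?_
    rw [pi_mul_besselJ_zero hx, hS, ← Complex.ofReal_mul]
    congr 1
    have e : (1 : ℂ) - Complex.I / (8 * x) - 9 / (128 * x ^ 2)
        = ((1 - 9 / (128 * x ^ 2) : ℝ) : ℂ) + ((-(1 / (8 * x)) : ℝ) : ℂ) * Complex.I := by
      push_cast
      ring
    have e2 : E * K * (D + μ * (1 - Complex.I / (8 * x) - 9 / (128 * x ^ 2)))
        = (K : ℂ) * (E * D) + ((K * μ : ℝ) : ℂ)
          * (E * (((1 - 9 / (128 * x ^ 2) : ℝ) : ℂ) + ((-(1 / (8 * x)) : ℝ) : ℂ) * Complex.I)) := by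
      rw [e]
      push_cast
      ring
    have e3 : (E * (((1 - 9 / (128 * x ^ 2) : ℝ) : ℂ)
        + ((-(1 / (8 * x)) : ℝ) : ℂ) * Complex.I)).im
        = Real.sin (x + Real.pi / 4) * (1 - 9 / (128 * x ^ 2))
          - Real.cos (x + Real.pi / 4) / (8 * x) := by
      rw [Complex.mul_im, hEre, hEim]
      simp only [Complex.add_re, Complex.add_im, Complex.ofReal_re, Complex.ofReal_im,
        Complex.re_ofReal_mul, Complex.im_ofReal_mul, Complex.I_re, Complex.I_im]
      ring
    rw [e2, Complex.add_im, Complex.im_ofReal_mul, Complex.im_ofReal_mul, e3]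
    field_simp
    ring

/-! ### From a real zero of `J₀` to a complex root of the characteristic equation -/

/-- Grönwall's inequality for Bessel's equation on the segment from a zero `j` of `J₀` to `j + h`:
both `J₀` and its derivative stay comparable with the derivative at `j`. -/
theorem norm_besselJ_near_zero_le {j : ℝ} (hj : 2 ≤ j) (h0 : besselJ 0 j = 0) {h : ℂ}
    (hh : ‖h‖ ≤ 1) :
    ‖besselJ 0 (j + h)‖ ≤ Real.exp 2 * ‖deriv (besselJ 0) j‖ ∧
      ‖deriv (besselJ 0) (j + h)‖ ≤ Real.exp 2 * ‖deriv (besselJ 0) j‖ := by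
  set F := besselJ 0
  have hre : ∀ t ∈ Set.Icc (0 : ℝ) 1, 1 ≤ ‖(j : ℂ) + t * h‖ := by
    intro t ht
    have h1 : ‖(t : ℂ) * h‖ ≤ 1 := by
      rw [norm_mul, Complex.norm_real, Real.norm_of_nonneg ht.1]
      exact mul_le_one₀ ht.2 (norm_nonneg _) hh
    have h2 : ‖(j : ℂ)‖ = j := by rw [Complex.norm_real, Real.norm_of_nonneg (by linarith)]
    have := norm_sub_le_norm_add (j : ℂ) (t * h)
    linarith
  have hlin : ∀ t : ℝ, HasDerivAt (fun t : ℝ => (j : ℂ) + t * h) h t := fun t => by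
    simpa using ((Complex.ofRealCLM.hasDerivAt (x := t)).mul_const h).const_add (j : ℂ)
  have hd : ∀ t ∈ Set.Icc (0 : ℝ) 1, HasDerivAt
      (fun t : ℝ => (F (j + t * h), deriv F (j + t * h)))
      (deriv F (j + t * h) * h,
        (-F (j + t * h) - deriv F (j + t * h) / (j + t * h)) * h) t := by
    intro t ht
    have hne : (j : ℂ) + t * h ≠ 0 := norm_pos_iff.1 (by linarith [hre t ht])
    have a := (differentiable_besselJ_zero ((j : ℂ) + t * h)).hasDerivAt.comp t (hlin t)
    have b := (hasDerivAt_deriv_besselJ_zero hne).comp t (hlin t)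
    exact a.prodMk b
  have hbd := norm_le_gronwallBound_of_norm_deriv_right_le
    (f := fun t : ℝ => (F (j + t * h), deriv F (j + t * h)))
    (f' := fun t : ℝ => (deriv F (j + t * h) * h,
        (-F (j + t * h) - deriv F (j + t * h) / (j + t * h)) * h))
    (δ := ‖deriv F j‖) (K := 2) (ε := 0) (a := 0) (b := 1)
    (fun t ht => (hd t ht).continuousAt.continuousWithinAt)
    (fun t ht => (hd t (Set.Ico_subset_Icc_self ht)).hasDerivWithinAt)
    (by
      rw [Complex.ofReal_zero, zero_mul, add_zero, h0, Prod.norm_def]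
      simp)
    (fun t ht => by
      have h1 := hre t (Set.Ico_subset_Icc_self ht)
      set z : ℂ := j + t * h
      have hF : ‖F z‖ ≤ ‖(F z, deriv F z)‖ := norm_fst_le (F z, deriv F z)
      have hF' : ‖deriv F z‖ ≤ ‖(F z, deriv F z)‖ := norm_snd_le (F z, deriv F z)
      have h2 : ‖deriv F z / z‖ ≤ ‖deriv F z‖ := by
        rw [norm_div]
        exact div_le_self (norm_nonneg _) h1
      rw [Prod.norm_def, add_zero]
      refine max_le ?_ ?_
      · rw [norm_mul]
        nlinarith [mul_le_of_le_one_right (norm_nonneg (deriv F z)) hh, norm_nonneg (F z)]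
      · rw [norm_mul]
        have h3 : ‖-F z - deriv F z / z‖ ≤ ‖F z‖ + ‖deriv F z / z‖ := by
          simpa using norm_sub_le (-F z) (deriv F z / z)
        have h4 := mul_le_of_le_one_right (norm_nonneg (-F z - deriv F z / z)) hh
        linarith)
    1 (by simp)
  rw [gronwallBound_ε0] at hbd
  have e : Real.exp (2 * (1 - 0)) = Real.exp 2 := by norm_num
  simp only [Complex.ofReal_one, one_mul, e, mul_comm ‖deriv F j‖] at hbd
  exact ⟨(norm_fst_le _).trans hbd, (norm_snd_le _).trans hbd⟩

/-- Second-order accurate Taylor approximations of `J₀` and `J₀'` in the disk of radius `2 / j`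
around a large real zero `j` of `J₀`. -/
theorem norm_besselJ_sub_linear_le {j : ℝ} (hj : 2 ≤ j) (h0 : besselJ 0 j = 0) {h : ℂ}
    (hh : ‖h‖ ≤ 2 / j) :
    ‖besselJ 0 (j + h) - deriv (besselJ 0) j * h‖
        ≤ 16 * Real.exp 2 * ‖deriv (besselJ 0) j‖ / j ^ 3 ∧
      ‖deriv (besselJ 0) (j + h) - deriv (besselJ 0) j‖
        ≤ 8 * Real.exp 2 * ‖deriv (besselJ 0) j‖ / j ^ 2 := by
  have hj0 : 0 < j := by linarith
  have hj1 : 2 / j ≤ 1 := (div_le_one hj0).2 hj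
  set F := besselJ 0
  set m := deriv F j
  set M := Real.exp 2
  have hM : 0 ≤ M := (Real.exp_pos 2).le
  have hconv := convex_closedBall (0 : ℂ) (2 / j)
  have hmem : ∀ {x : ℂ}, x ∈ Metric.closedBall (0 : ℂ) (2 / j) ↔ ‖x‖ ≤ 2 / j := by simp
  have hz : (0 : ℂ) ∈ Metric.closedBall (0 : ℂ) (2 / j) := by
    rw [hmem, norm_zero]
    positivity
  have hnorm : ∀ x : ℂ, ‖x‖ ≤ 2 / j → j / 2 ≤ ‖(j : ℂ) + x‖ := by
    intro x hx
    have h2 : ‖(j : ℂ)‖ = j := by rw [Complex.norm_real, Real.norm_of_nonneg hj0.le]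
    have := norm_sub_le_norm_add (j : ℂ) x
    linarith
  have dF : ∀ x : ℂ, HasDerivAt (fun x : ℂ => F (j + x)) (deriv F (j + x)) x := fun x =>
    (differentiable_besselJ_zero ((j : ℂ) + x)).hasDerivAt.comp_const_add (j : ℂ) x
  -- `J₀` is of size `|h|` because it vanishes at `j`
  have b0 : ∀ x : ℂ, ‖x‖ ≤ 2 / j → ‖F (j + x)‖ ≤ M * ‖m‖ * (2 / j) := by
    intro x hx
    have := hconv.norm_image_sub_le_of_norm_hasDerivWithin_le
      (fun y _ => (dF y).hasDerivWithinAt)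
      (fun y hy => (norm_besselJ_near_zero_le hj h0 ((hmem.1 hy).trans hj1)).2) hz (hmem.2 hx)
    simp only [add_zero, sub_zero] at this
    rw [show F j = 0 from h0, sub_zero] at this
    exact this.trans (by gcongr)
  have b1 : ∀ x : ℂ, ‖x‖ ≤ 2 / j → ‖deriv F (j + x) - m‖ ≤ 8 * M * ‖m‖ / j ^ 2 := by
    intro x hx
    have := hconv.norm_image_sub_le_of_norm_hasDerivWithin_le
      (f := fun x : ℂ => deriv F (j + x))
      (f' := fun x : ℂ => -F (j + x) - deriv F (j + x) / (j + x))
      (C := 4 * M * ‖m‖ / j)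
      (fun y hy => by
        have hne : (j : ℂ) + y ≠ 0 := norm_pos_iff.1 (by linarith [hnorm y (hmem.1 hy)])
        exact ((hasDerivAt_deriv_besselJ_zero hne).comp_const_add (j : ℂ) y).hasDerivWithinAt)
      (fun y hy => by
        have hy' := hmem.1 hy
        have h1 := (norm_besselJ_near_zero_le hj h0 (hy'.trans hj1)).2
        have h2 : ‖deriv F (j + y) / (j + y)‖ ≤ M * ‖m‖ / (j / 2) := by
          rw [norm_div]
          exact div_le_div₀ (by positivity) h1 (by positivity) (hnorm y hy')
        have h3 : ‖-F (j + y) - deriv F (j + y) / (j + y)‖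
            ≤ ‖F (j + y)‖ + ‖deriv F (j + y) / (j + y)‖ := by
          simpa using norm_sub_le (-F (j + y)) (deriv F (j + y) / (j + y))
        calc _ ≤ M * ‖m‖ * (2 / j) + M * ‖m‖ / (j / 2) := by linarith [b0 y hy']
          _ = _ := by field_simp; ring) hz (hmem.2 hx)
    simp only [add_zero, sub_zero] at this
    calc _ ≤ 4 * M * ‖m‖ / j * (2 / j) := this.trans (by gcongr)
      _ = _ := by field_simp; ring
  refine ⟨?_, b1 h hh⟩
  have := hconv.norm_image_sub_le_of_norm_hasDerivWithin_le
    (f := fun x : ℂ => F (j + x) - m * x) (f' := fun x : ℂ => deriv F (j + x) - m)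
    (C := 8 * M * ‖m‖ / j ^ 2)
    (fun y _ => by
      have := (dF y).sub ((hasDerivAt_id y).const_mul m)
      rw [mul_one] at this
      exact this.hasDerivWithinAt)
    (fun y hy => b1 y (hmem.1 hy)) hz (hmem.2 hh)
  simp only [add_zero, sub_zero, mul_zero] at this
  rw [show F j = 0 from h0, sub_zero] at this
  calc _ ≤ 8 * M * ‖m‖ / j ^ 2 * (2 / j) := this.trans (by gcongr)
    _ = _ := by field_simp; ring

/-- Every large real zero `j` of `J₀` has a root of the characteristic equation within `O(j⁻³)`
of `j + 1 / (j - i)`. -/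
theorem exists_root_near_besselJ_zero : ∃ C K : ℝ, ∀ j : ℝ, K ≤ j → besselJ 0 j = 0 →
    ∃ l : ℂ, (Complex.I * l - l ^ 2) * besselJ 0 l + l * deriv (besselJ 0) l = 0 ∧
      ‖l - (j + 1 / (j - Complex.I))‖ ≤ C / j ^ 3 := by
  set M := Real.exp 2
  have hM : 0 < M := Real.exp_pos 2
  -- `16 M`, `8 M * 2` and `4` come from `J₀`, from `J₀'`, and from replacing `j + h - i` by `j - i`
  set C : ℝ := 32 * M + 4 with hC
  have hC0 : 0 < C := by positivity
  refine ⟨5 * C, 2 + 5 * C, fun j hjK h0 => ?_⟩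
  have hj : 2 ≤ j := by linarith
  have hj0 : 0 < j := by linarith
  have hj1 : 2 / j ≤ 1 := (div_le_one hj0).2 hj
  set F := besselJ 0
  set m := deriv F j
  have hden : ∀ x : ℂ, ‖x‖ ≤ 2 / j → j / 2 ≤ ‖(j : ℂ) + x - Complex.I‖ := by
    intro x hx
    have h1 := Complex.re_le_norm ((j : ℂ) + x - Complex.I)
    have h2 := (abs_le.1 ((Complex.abs_re_le_norm x).trans hx)).1
    simp at h1
    linarith
  have hden0 : j ≤ ‖(j : ℂ) - Complex.I‖ := by
    simpa using Complex.re_le_norm ((j : ℂ) - Complex.I)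
  have hne0 : (j : ℂ) - Complex.I ≠ 0 := norm_pos_iff.1 (by linarith)
  have hne : ∀ x : ℂ, ‖x‖ ≤ 2 / j → (j : ℂ) + x - Complex.I ≠ 0 := fun x hx =>
    norm_pos_iff.1 (by linarith [hden x hx])
  set G : ℂ → ℂ := fun h => F (j + h) - deriv F (j + h) / (j + h - Complex.I) with hG
  set c : ℂ := 1 / (j - Complex.I) with hc
  have hc1 : ‖c‖ ≤ 1 / j := by
    rw [hc, norm_div, norm_one]
    exact one_div_le_one_div_of_le hj0 hden0
  -- a zero of `G` yields a root
  have hroot : ∀ h : ℂ, ‖h‖ ≤ 2 / j → G h = 0 →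
      (Complex.I * (j + h) - (j + h) ^ 2) * F (j + h) + (j + h) * deriv F (j + h) = 0 := by
    intro h hh hGh
    have := hne h hh
    simp only [hG] at hGh
    have h2 : F (j + h) * (j + h - Complex.I) = deriv F (j + h) := by
      field_simp at hGh
      linear_combination hGh
    rw [← h2]
    ring
  have happrox : ∀ h : ℂ, ‖h‖ ≤ 2 / j → ‖G h - m * (h - c)‖ ≤ C * ‖m‖ / j ^ 3 := by
    intro h hh
    obtain ⟨h1, h2⟩ := norm_besselJ_sub_linear_le hj h0 hh
    have e : G h - m * (h - c) = (F (j + h) - m * h)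
        - (deriv F (j + h) - m) / (j + h - Complex.I)
        + m * h / ((j + h - Complex.I) * (j - Complex.I)) := by
      have := hne h hh
      simp only [hG, hc]
      field_simp
      ring
    have h3 : ‖(deriv F (j + h) - m) / (j + h - Complex.I)‖
        ≤ 8 * M * ‖m‖ / j ^ 2 / (j / 2) := by
      rw [norm_div]
      exact div_le_div₀ (by positivity) h2 (by positivity) (hden h hh)
    have h4 : ‖m * h / ((j + h - Complex.I) * (j - Complex.I))‖
        ≤ ‖m‖ * (2 / j) / (j / 2 * j) := by
      rw [norm_div, norm_mul, norm_mul]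
      exact div_le_div₀ (by positivity) (by gcongr) (by positivity)
        (mul_le_mul (hden h hh) hden0 hj0.le (norm_nonneg _))
    calc ‖G h - m * (h - c)‖ ≤ 16 * M * ‖m‖ / j ^ 3 + 8 * M * ‖m‖ / j ^ 2 / (j / 2)
          + ‖m‖ * (2 / j) / (j / 2 * j) := by
          rw [e]
          refine (norm_add_le _ _).trans (add_le_add ((norm_sub_le _ _).trans ?_) h4)
          exact add_le_add h1 h3
      _ = C * ‖m‖ / j ^ 3 := by
          rw [hC]
          field_simp
          ring
  have hcc : ‖c‖ ≤ 2 / j := hc1.trans (by gcongr; norm_num)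
  have hGc : ‖G c‖ ≤ C * ‖m‖ / j ^ 3 := by simpa using happrox c hcc
  -- if `J₀'(j) = 0` as well, then `G` vanishes on the whole disk `‖h‖ ≤ 2 / j`
  by_cases hm : m = 0
  · refine ⟨j + c, hroot c hcc ?_, ?_⟩
    · rw [hm, norm_zero, mul_zero, zero_div] at hGc
      exact norm_le_zero_iff.1 hGc
    · rw [sub_self, norm_zero]
      positivity
  have hm0 : 0 < ‖m‖ := norm_pos_iff.2 hm
  -- on the circle of radius `5 C / j ^ 3` around `c`, the variation of the linear part `m (h - c)`
  -- exceeds the errors made at `h` and at `c` by `3 C ‖m‖ / j ^ 3`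
  set r : ℝ := 5 * C / j ^ 3 with hr
  have hr0 : 0 < r := by positivity
  have hr1 : r < 1 / j := by
    rw [hr, div_lt_div_iff₀ (by positivity) hj0]
    have : 5 * C < j ^ 2 := by nlinarith
    calc 5 * C * j < j ^ 2 * j := by gcongr
      _ = _ := by ring
  have hsub : ∀ x ∈ Metric.closedBall c r, ‖x‖ < 2 / j := by
    intro x hx
    have h1 : ‖x - c‖ ≤ r := by simpa [dist_eq_norm] using hx
    have h2 : ‖x‖ ≤ ‖x - c‖ + ‖c‖ := by simpa using norm_add_le (x - c) c
    have h3 : 2 / j = 1 / j + 1 / j := by ring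
    linarith
  have hGd : DifferentiableOn ℂ G (Metric.ball 0 (2 / j)) := by
    intro x hx
    have hx' : ‖x‖ ≤ 2 / j := by simpa using (Metric.mem_ball.1 hx).le
    have hFd : Differentiable ℂ F := differentiable_besselJ_zero
    have hFd' : Differentiable ℂ (deriv F) :=
      (hFd.contDiff (n := 2)).differentiable_deriv_two
    have h3 : DifferentiableAt ℂ (fun h : ℂ => (j : ℂ) + h) x := by fun_prop
    have h4 : DifferentiableAt ℂ (fun h : ℂ => (j : ℂ) + h - Complex.I) x := by fun_prop
    exact (((hFd _).comp x h3).sub (((hFd' _).comp x h3).div h4 (hne x hx'))).differentiableWithinAt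
  have hGs : ∀ x ∈ Metric.sphere c r, 3 * (C * ‖m‖ / j ^ 3) ≤ ‖G x - G c‖ := by
    intro x hx
    have h1 : ‖x - c‖ = r := by simpa [dist_eq_norm] using hx
    have h2 := happrox x (hsub x (Metric.sphere_subset_closedBall hx)).le
    have h3 : ‖m * (x - c)‖ = 5 * (C * ‖m‖ / j ^ 3) := by
      rw [norm_mul, h1, hr]
      ring
    have h4 : m * (x - c) = (G x - G c) - (G x - m * (x - c)) + G c := by ring
    have h5 : ‖m * (x - c)‖ ≤ ‖G x - G c‖ + ‖G x - m * (x - c)‖ + ‖G c‖ := by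
      conv_lhs => rw [h4]
      exact (norm_add_le _ _).trans (add_le_add_left (norm_sub_le _ _) _)
    linarith
  have hGnc : ∃ᶠ x in 𝓝 c, G x ≠ G c := by
    intro hev
    have hev' : G =ᶠ[𝓝 c] fun _ => G c := hev.mono fun x hx => not_not.1 hx
    have hcb : c ∈ Metric.ball (0 : ℂ) (2 / j) := by
      simpa using hsub c (Metric.mem_closedBall_self hr0.le)
    have heq := (hGd.analyticOnNhd Metric.isOpen_ball).eqOn_of_preconnected_of_eventuallyEq
      analyticOnNhd_const (convex_ball (0 : ℂ) (2 / j)).isPreconnected hcb hev'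
    have hxs : c + r ∈ Metric.sphere c r := by simp [hr0.le]
    have h1 := hGs _ hxs
    rw [heq (by simpa using hsub _ (Metric.sphere_subset_closedBall hxs)), sub_self,
      norm_zero] at h1
    have : 0 < 3 * (C * ‖m‖ / j ^ 3) := by positivity
    linarith
  have himg := DiffContOnCl.ball_subset_image_closedBall
    (hGd.diffContOnCl_ball fun x hx => by simpa using hsub x hx) hr0 hGs hGnc
  have h0mem : (0 : ℂ) ∈ Metric.ball (G c) (3 * (C * ‖m‖ / j ^ 3) / 2) := by
    rw [Metric.mem_ball, dist_eq_norm, zero_sub, norm_neg]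
    have : 0 < C * ‖m‖ / j ^ 3 := by positivity
    linarith
  obtain ⟨h, hh, hGh⟩ := himg h0mem
  refine ⟨j + h, hroot h (hsub h hh).le hGh, ?_⟩
  rw [add_sub_add_left_eq_sub]
  simpa [dist_eq_norm] using hh

/-! ### Zeros of `J₀` and roots of the characteristic equation -/

theorem two_mul_natCast_le_phase {k : ℕ} (hk : 1 ≤ k) : 2 * (k : ℝ) ≤ phase k := by
  have h1 : (1 : ℝ) ≤ k := by exact_mod_cast hk
  rw [phase]
  nlinarith [Real.pi_gt_three, Real.pi_lt_four]

/-- Just to the right of `φ = kπ - π/4`, the function `(-1)^k J₀` has the sign of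
`x - φ - 1 / (8φ)`, up to an error `O(φ⁻³)`. -/
theorem besselJ_zero_near_phase {k : ℕ} {η : ℝ} (hφ : 1 ≤ phase k) (h0 : 0 ≤ η)
    (h1 : η ≤ 1 / (4 * phase k)) : ∃ c d : ℝ, 0 < c ∧ |d| ≤ 6 / phase k ^ 3 ∧
      besselJ 0 ((phase k + η : ℝ) : ℂ)
        = (((-1) ^ k * (c * (η - 1 / (8 * phase k) + d)) : ℝ) : ℂ) := by
  set φ := phase k with hφd
  have hφ0 : 0 < φ := by linarith
  set x := φ + η with hx
  have hx0 : 0 < x := by linarith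
  obtain ⟨c, e, hc, he, hJ⟩ := besselJ_zero_hankel hx0
  set t := 1 / φ with ht
  have ht0 : 0 < t := by positivity
  have ht1 : t ≤ 1 := (div_le_one hφ0).2 hφ
  have hηt : η ≤ t / 4 := h1.trans (le_of_eq (by rw [ht]; field_simp))
  set y := 1 / x with hy
  have hy0 : 0 < y := by positivity
  have hyt : y ≤ t := one_div_le_one_div_of_le hφ0 (by linarith)
  have hty : t - y = η * t * y := by
    rw [ht, hy]
    field_simp
    rw [hx]
    ring
  have harg : x + Real.pi / 4 = η + k * Real.pi := by
    rw [hx, hφd, phase]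
    ring
  have hcosk : Real.cos (η + k * Real.pi) = (-1) ^ k * Real.cos η := Real.cos_add_nat_mul_pi η k
  have hsink : Real.sin (η + k * Real.pi) = (-1) ^ k * Real.sin η := Real.sin_add_nat_mul_pi η k
  have hsq : ((-1 : ℝ) ^ k) * (-1) ^ k = 1 := by
    rw [← mul_pow]
    norm_num
  -- with `y = 1 / x`, the sum of the errors in `sin η ≈ η` and `cos η / x ≈ 1 / φ`, of the term of
  -- second order, and of the remainder in Hankel's expansion
  set d := (Real.sin η - η) - Real.sin η * (9 / 128 * y ^ 2) + (t - Real.cos η * y) / 8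
    + (-1) ^ k * e with hd
  refine ⟨c, d, hc, ?_, ?_⟩
  · have b1 : |Real.sin η - η| ≤ t ^ 3 := by
      have hs1 : Real.sin η ≤ η := Real.sin_le h0
      have hs2 : η - η ^ 3 / 6 ≤ Real.sin η := by
        rcases h0.eq_or_lt with h | h
        · simp [← h]
        · exact (Real.sin_gt_sub_cube h).le
      have : η ^ 3 ≤ t ^ 3 := pow_le_pow_left₀ h0 (by linarith) 3
      rw [abs_le]
      constructor <;> nlinarith [pow_pos ht0 3]
    have b2 : |Real.sin η * (9 / 128 * y ^ 2)| ≤ t ^ 3 := by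
      rw [abs_mul, abs_of_nonneg (by positivity : 0 ≤ 9 / 128 * y ^ 2)]
      have hs : |Real.sin η| ≤ t := (Real.abs_sin_le_abs (x := η)).trans
        (by rw [abs_of_nonneg h0]; linarith)
      calc |Real.sin η| * (9 / 128 * y ^ 2) ≤ t * (1 * t ^ 2) := by
            gcongr
            norm_num
        _ = t ^ 3 := by ring
    have b3 : |(t - Real.cos η * y) / 8| ≤ t ^ 3 := by
      have e1 : t - Real.cos η * y = η * t * y + (1 - Real.cos η) * y := by
        rw [← hty]
        ring
      have hc1 : 1 - Real.cos η ≤ η ^ 2 / 2 := by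
        linarith [Real.one_sub_sq_div_two_le_cos (x := η)]
      have hc2 : 0 ≤ 1 - Real.cos η := by linarith [Real.cos_le_one η]
      have k1 : η * t * y ≤ t ^ 3 := by
        calc η * t * y ≤ t * t * t := by
              gcongr
              linarith
          _ = t ^ 3 := by ring
      have k2 : (1 - Real.cos η) * y ≤ t ^ 3 := by
        have : 1 - Real.cos η ≤ t ^ 2 := by nlinarith
        calc (1 - Real.cos η) * y ≤ t ^ 2 * t := by gcongr
          _ = t ^ 3 := by ring
      have k3 : 0 ≤ η * t * y := by positivity
      have k4 : 0 ≤ (1 - Real.cos η) * y := by positivity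
      rw [abs_of_nonneg (by rw [e1]; positivity), e1]
      linarith
    have b4 : |(-1) ^ k * e| ≤ 15 / 8 * t ^ 3 := by
      rw [abs_mul, abs_pow, abs_neg, abs_one, one_pow, one_mul]
      refine he.trans ?_
      rw [div_eq_mul_one_div, ← one_div_pow]
      gcongr
    have b5 : 6 / φ ^ 3 = 6 * t ^ 3 := by
      rw [ht]
      field_simp
    rw [b5, hd]
    rw [abs_le] at *
    constructor <;> linarith [b1.1, b1.2, b2.1, b2.2, b3.1, b3.2, b4.1, b4.2, pow_pos ht0 3]
  · rw [hJ, harg, hcosk, hsink]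
    congr 1
    have e1 : 9 / (128 * x ^ 2) = 9 / 128 * y ^ 2 := by
      rw [hy]
      field_simp
    have e2 : ∀ a : ℝ, a / (8 * x) = a * y / 8 := fun a => by
      rw [hy]
      field_simp
    have e3 : 1 / (8 * φ) = t / 8 := by
      rw [ht]
      field_simp
    rw [e1, e2, e3, hd]
    linear_combination (-c * e) * hsq

/-- McMahon's expansion: `J₀` has a real zero within `O(φ⁻³)` of `φ + 1 / (8φ)`, `φ = kπ - π/4`. -/
theorem exists_besselJ_zero_near_phase {k : ℕ} (hφ : 7 ≤ phase k) :
    ∃ j : ℝ, besselJ 0 j = 0 ∧ |j - (phase k + 1 / (8 * phase k))| ≤ 6 / phase k ^ 3 ∧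
      phase k ≤ j ∧ j ≤ phase k + 1 / (4 * phase k) := by
  set φ := phase k with hφd
  have hφ0 : 0 < φ := by linarith
  have hδ : 6 / φ ^ 3 ≤ 1 / (8 * φ) := by
    rw [div_le_div_iff₀ (by positivity) (by positivity)]
    nlinarith [mul_nonneg hφ0.le (by nlinarith : 0 ≤ φ ^ 2 - 49)]
  have hδ0 : 0 < 6 / φ ^ 3 := by positivity
  have hq : 1 / (4 * φ) = 1 / (8 * φ) + 1 / (8 * φ) := by
    field_simp
    norm_num
  have hsq : ((-1 : ℝ) ^ k) * (-1) ^ k = 1 := by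
    rw [← mul_pow]
    norm_num
  set g : ℝ → ℝ := fun x => (-1) ^ k * (besselJ 0 (x : ℂ)).re with hg
  have hgc : Continuous g := continuous_const.mul
    (Complex.continuous_re.comp (differentiable_besselJ_zero.continuous.comp
      Complex.continuous_ofReal))
  have hval : ∀ η, 0 ≤ η → η ≤ 1 / (4 * φ) → ∃ c d : ℝ, 0 < c ∧ |d| ≤ 6 / φ ^ 3 ∧
      g (φ + η) = c * (η - 1 / (8 * φ) + d) := by
    intro η h0 h1
    obtain ⟨c, d, hc, hd, hJ⟩ := besselJ_zero_near_phase (k := k) (by linarith) h0 h1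
    refine ⟨c, d, hc, hd, ?_⟩
    simp only [hg]
    rw [hJ, Complex.ofReal_re]
    linear_combination (c * (η - 1 / (8 * φ) + d)) * hsq
  obtain ⟨c1, d1, hc1, hd1, hv1⟩ := hval (1 / (8 * φ) - 6 / φ ^ 3) (by linarith) (by linarith)
  obtain ⟨c2, d2, hc2, hd2, hv2⟩ := hval (1 / (8 * φ) + 6 / φ ^ 3) (by linarith) (by linarith)
  rw [abs_le] at hd1 hd2
  have hg1 : g (φ + (1 / (8 * φ) - 6 / φ ^ 3)) ≤ 0 := by
    rw [hv1]
    exact mul_nonpos_of_nonneg_of_nonpos hc1.le (by linarith [hd1.2])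
  have hg2 : 0 ≤ g (φ + (1 / (8 * φ) + 6 / φ ^ 3)) := by
    rw [hv2]
    exact mul_nonneg hc2.le (by linarith [hd2.1])
  obtain ⟨j, hj, hgj⟩ := intermediate_value_Icc
    (by linarith : φ + (1 / (8 * φ) - 6 / φ ^ 3) ≤ φ + (1 / (8 * φ) + 6 / φ ^ 3))
    hgc.continuousOn ⟨hg1, hg2⟩
  have hjl : φ ≤ j := by linarith [hj.1]
  have hju : j ≤ φ + 1 / (4 * φ) := by linarith [hj.2]
  refine ⟨j, ?_, ?_, hjl, hju⟩
  · obtain ⟨c, d, hc, hd, hJ⟩ := besselJ_zero_near_phase (k := k) (η := j - φ) (by linarith)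
      (by linarith) (by linarith)
    rw [← hφd, add_sub_cancel] at hJ
    have hne : (-1 : ℝ) ^ k ≠ 0 := pow_ne_zero _ (by norm_num)
    have h0 : (besselJ 0 (j : ℂ)).re = 0 := (mul_eq_zero.1 hgj).resolve_left hne
    rw [hJ, Complex.ofReal_re] at h0
    rw [hJ, h0, Complex.ofReal_zero]
  · rw [abs_le]
    constructor <;> linarith [hj.1, hj.2]

theorem phase_approx_eq {φ : ℝ} (hφ : 0 < φ) :
    (φ : ℂ) + 1 / (8 * (φ : ℂ)) + (φ : ℂ) / (1 + (φ : ℂ) ^ 2) + Complex.I / (1 + (φ : ℂ) ^ 2)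
      = φ + 1 / (8 * (φ : ℂ)) + 1 / (φ - Complex.I) := by
  have h1 : (φ : ℂ) - Complex.I ≠ 0 := fun h => by
    have := congrArg Complex.re h
    simp at this
    linarith
  have h2 : (1 : ℂ) + (φ : ℂ) ^ 2 ≠ 0 := by
    have : (0 : ℝ) < 1 + φ ^ 2 := by positivity
    exact_mod_cast this.ne'
  rw [add_assoc _ ((φ : ℂ) / _), ← add_div]
  congr 1
  rw [div_eq_div_iff h2 h1]
  linear_combination -Complex.I_sq

theorem exists_isRootSequence : ∃ lam : ℕ → ℂ, IsRootSequence lam := by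
  obtain ⟨C, K, hCK⟩ := exists_root_near_besselJ_zero
  have key : ∀ k : ℕ, 7 ≤ phase k → K ≤ phase k → ∃ l : ℂ,
      (Complex.I * l - l ^ 2) * besselJ 0 l + l * deriv (besselJ 0) l = 0 ∧
      ‖l - ((phase k : ℂ) + 1 / (8 * (phase k : ℂ)) + (phase k : ℂ) / (1 + (phase k : ℂ) ^ 2)
        + Complex.I / (1 + (phase k : ℂ) ^ 2))‖ ≤ (|C| + 7) / phase k ^ 3 := by
    intro k h7 hK
    obtain ⟨j, hj0, hj, hjl, hju⟩ := exists_besselJ_zero_near_phase h7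
    set φ := phase k
    have hφ0 : 0 < φ := by linarith
    obtain ⟨l, hl, hlj⟩ := hCK j (hK.trans hjl) hj0
    refine ⟨l, hl, ?_⟩
    rw [phase_approx_eq hφ0]
    have hlow : ∀ a : ℝ, a ≤ ‖(a : ℂ) - Complex.I‖ := fun a => by
      simpa using Complex.re_le_norm ((a : ℂ) - Complex.I)
    have hne : ∀ a : ℝ, 0 < a → (a : ℂ) - Complex.I ≠ 0 := fun a ha =>
      norm_pos_iff.1 (ha.trans_le (hlow a))
    have n1 : ‖l - (j + 1 / (j - Complex.I))‖ ≤ |C| / φ ^ 3 :=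
      hlj.trans (div_le_div₀ (abs_nonneg _) (le_abs_self C) (by positivity)
        (pow_le_pow_left₀ hφ0.le hjl 3))
    have n2 : ‖((j - (φ + 1 / (8 * φ)) : ℝ) : ℂ)‖ ≤ 6 / φ ^ 3 := by
      rwa [Complex.norm_real, Real.norm_eq_abs]
    have n3 : ‖(1 : ℂ) / (j - Complex.I) - 1 / (φ - Complex.I)‖ ≤ 1 / φ ^ 3 := by
      have e : (1 : ℂ) / (j - Complex.I) - 1 / (φ - Complex.I)
          = ((φ - j : ℝ) : ℂ) / ((j - Complex.I) * (φ - Complex.I)) := by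
        have := hne j (by linarith)
        have := hne φ hφ0
        push_cast
        field_simp
        ring
      have hd : |φ - j| ≤ 1 / φ := by
        have : 1 / (4 * φ) ≤ 1 / φ := one_div_le_one_div_of_le hφ0 (by linarith)
        rw [abs_le]
        constructor <;> linarith [one_div_pos.2 hφ0]
      rw [e, norm_div, norm_mul, Complex.norm_real, Real.norm_eq_abs]
      calc |φ - j| / (‖(j : ℂ) - Complex.I‖ * ‖(φ : ℂ) - Complex.I‖) ≤ (1 / φ) / (φ * φ) :=
            div_le_div₀ (by positivity) hd (by positivity)
              (mul_le_mul (hjl.trans (hlow j)) (hlow φ) hφ0.le (norm_nonneg _))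
        _ = 1 / φ ^ 3 := by field_simp
    have e : l - (φ + 1 / (8 * (φ : ℂ)) + 1 / (φ - Complex.I))
        = (l - (j + 1 / (j - Complex.I))) + ((j - (φ + 1 / (8 * φ)) : ℝ) : ℂ)
          + (1 / (j - Complex.I) - 1 / (φ - Complex.I)) := by
      push_cast
      ring
    rw [e]
    calc _ ≤ |C| / φ ^ 3 + 6 / φ ^ 3 + 1 / φ ^ 3 :=
          (norm_add_le _ _).trans (add_le_add ((norm_add_le _ _).trans (add_le_add n1 n2)) n3)
      _ = _ := by ring
  choose! lam hlam using key
  obtain ⟨N, hN⟩ := exists_nat_ge (max 7 K)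
  have hlarge : ∀ᶠ k : ℕ in atTop, 1 ≤ k ∧ 7 ≤ phase k ∧ K ≤ phase k := by
    filter_upwards [eventually_ge_atTop (max 1 N)] with k hk
    have h1 := two_mul_natCast_le_phase ((le_max_left _ _).trans hk)
    have h2 : (N : ℝ) ≤ k := by exact_mod_cast (le_max_right _ _).trans hk
    have h3 : (7 : ℝ) ≤ N := (le_max_left _ _).trans hN
    have h4 : K ≤ N := (le_max_right _ _).trans hN
    exact ⟨(le_max_left _ _).trans hk, by linarith, by linarith⟩
  refine ⟨lam, ?_, IsBigO.of_bound (|C| + 7) ?_⟩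
  · filter_upwards [hlarge] with k hk
    exact (hlam k hk.2.1 hk.2.2).1
  · filter_upwards [hlarge] with k hk
    refine (hlam k hk.2.1 hk.2.2).2.trans ?_
    have hk0 : (0 : ℝ) < k := by exact_mod_cast hk.1
    rw [Real.norm_of_nonneg (by positivity), ← div_eq_mul_one_div]
    have : (k : ℝ) ≤ phase k := by linarith [two_mul_natCast_le_phase hk.1]
    gcongr

/-- A root sequence runs to infinity and approaches the real axis quadratically. -/
theorem IsRootSequence.eventually_bounds {lam : ℕ → ℂ} (h : IsRootSequence lam) :
    ∃ D : ℝ, 0 < D ∧ ∀ᶠ k : ℕ in atTop, 1 ≤ (lam k).re ∧ (k : ℝ) ≤ (lam k).re ∧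
      |(lam k).im| ≤ D / (lam k).re ^ 2 := by
  obtain ⟨C, hC, hb⟩ := h.2.exists_pos
  obtain ⟨N, hN⟩ := exists_nat_ge (2 + C)
  refine ⟨25 * (1 + C), by positivity, ?_⟩
  filter_upwards [hb.bound, eventually_ge_atTop (max 1 N)] with k hk hkN
  have hk1 : 1 ≤ k := (le_max_left _ _).trans hkN
  have hk1' : (1 : ℝ) ≤ k := by exact_mod_cast hk1
  have hk2 : 2 + C ≤ k := hN.trans (by exact_mod_cast (le_max_right _ _).trans hkN)
  have hφl := two_mul_natCast_le_phase hk1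
  have hφu : phase k ≤ 4 * k := by
    rw [phase]
    nlinarith [Real.pi_lt_four, Real.pi_pos]
  set φ := phase k
  have hφ0 : 0 < φ := by linarith
  rw [Real.norm_of_nonneg (by positivity)] at hk
  have e : (φ : ℂ) + 1 / (8 * (φ : ℂ)) + (φ : ℂ) / (1 + (φ : ℂ) ^ 2) + Complex.I / (1 + (φ : ℂ) ^ 2)
      = ((φ + 1 / (8 * φ) + φ / (1 + φ ^ 2) : ℝ) : ℂ)
        + ((1 / (1 + φ ^ 2) : ℝ) : ℂ) * Complex.I := by
    push_cast
    ring
  rw [e] at hk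
  have hre := (Complex.abs_re_le_norm _).trans hk
  have him := (Complex.abs_im_le_norm _).trans hk
  rw [Complex.sub_re, Complex.add_re, Complex.ofReal_re, Complex.re_ofReal_mul, Complex.I_re,
    mul_zero, add_zero] at hre
  rw [Complex.sub_im, Complex.add_im, Complex.ofReal_im, Complex.im_ofReal_mul, Complex.I_im,
    mul_one, zero_add] at him
  have hCk : C * (1 / (k : ℝ) ^ 3) ≤ C * (1 / (k : ℝ) ^ 2) := by
    gcongr C * (1 / ?_)
    exact pow_le_pow_right₀ hk1' (by norm_num)
  have hCk1 : C * (1 / (k : ℝ) ^ 2) ≤ C :=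
    mul_le_of_le_one_right hC.le ((div_le_one (by positivity)).2 (one_le_pow₀ hk1'))
  have q1 : 1 / (8 * φ) ≤ 1 := (div_le_one (by positivity)).2 (by linarith)
  have q2 : φ / (1 + φ ^ 2) ≤ 1 := (div_le_one (by positivity)).2 (by nlinarith)
  have q3 : 0 < 1 / (8 * φ) := by positivity
  have q4 : 0 < φ / (1 + φ ^ 2) := by positivity
  have q5 : 1 / (1 + φ ^ 2) ≤ 1 / (k : ℝ) ^ 2 :=
    one_div_le_one_div_of_le (by positivity) (by nlinarith)
  have q6 : 0 < 1 / (1 + φ ^ 2) := by positivity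
  rw [abs_le] at hre him
  have hlo : (k : ℝ) ≤ (lam k).re := by linarith [hre.1]
  have hup : (lam k).re ≤ 5 * k := by linarith [hre.2]
  have hpos : 0 < (lam k).re := by linarith
  refine ⟨by linarith, hlo, ?_⟩
  have h1 : |(lam k).im| ≤ (1 + C) * (1 / (k : ℝ) ^ 2) := by
    rw [abs_le]
    constructor <;> linarith [him.1, him.2]
  refine h1.trans ?_
  rw [← div_eq_mul_one_div, div_le_div_iff₀ (by positivity) (by positivity)]
  have : (lam k).re ^ 2 ≤ (5 * k) ^ 2 := pow_le_pow_left₀ hpos.le hup 2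
  nlinarith

/-! ### The quasimode estimate -/

/-- An eigenvector for `i l` is a quasimode for `i Re l`: the pencil changes by
`O(|Im l| · (1 + |l|))` between the two points. -/
theorem norm_pencil_re_le {l : ℂ} {u : A.domain} (hu : pencil (Complex.I * l) u = 0)
    (h1 : ‖(u : H)‖ = 1) {D : ℝ} (hre : 1 ≤ l.re) (him : |l.im| ≤ D / l.re ^ 2) :
    ‖pencil (Complex.I * (l.re : ℂ)) u‖ ≤ D * (D + 3) * (l.re)⁻¹ := by
  set τ := l.re with hτ
  have hτ0 : 0 < τ := by linarith
  have hD0 : 0 ≤ D := by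
    have := (abs_nonneg _).trans him
    rwa [le_div_iff₀ (by positivity), zero_mul] at this
  have hl : l = τ + l.im * Complex.I := (Complex.re_add_im l).symm
  have e : pencil (Complex.I * (τ : ℂ)) u
      = (l.im : ℂ) • (WithLp.toLp 2 (0, (u : H).snd) : H)
        + ((l.im : ℂ) * (2 * τ * Complex.I - l.im)) • (u : H) := by
    have c1 : Complex.I * (τ : ℂ) - Complex.I * l = l.im := by
      conv_lhs => rw [hl]
      linear_combination (-(l.im : ℂ)) * Complex.I_sq
    have c2 : (Complex.I * (τ : ℂ)) ^ 2 - (Complex.I * l) ^ 2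
        = (l.im : ℂ) * (2 * τ * Complex.I - l.im) := by
      conv_lhs => rw [hl]
      linear_combination (-2 * τ * l.im * Complex.I - (l.im : ℂ) ^ 2 * Complex.I ^ 2
        + (l.im : ℂ) ^ 2) * Complex.I_sq
    rw [← sub_zero (pencil (Complex.I * (τ : ℂ)) u), ← hu, pencil_apply, pencil_apply, ← c2, ← c1,
      sub_smul, sub_smul]
    abel
  have hsnd : ‖(WithLp.toLp 2 (0, (u : H).snd) : H)‖ ≤ 1 := by
    rw [← h1]
    have a1 := WithLp.prod_norm_sq_eq_of_L2 (WithLp.toLp 2 ((0 : L2Disk), (u : H).snd) : H)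
    have a2 := WithLp.prod_norm_sq_eq_of_L2 (u : H)
    have a3 : (WithLp.toLp 2 ((0 : L2Disk), (u : H).snd) : H).fst = 0 := rfl
    have a4 : (WithLp.toLp 2 ((0 : L2Disk), (u : H).snd) : H).snd = (u : H).snd := rfl
    rw [a3, a4, norm_zero] at a1
    refine abs_le_of_sq_le_sq' ?_ (norm_nonneg _) |>.2
    nlinarith [sq_nonneg ‖(u : H).fst‖]
  have himD : |l.im| ≤ D := him.trans (div_le_self hD0 (one_le_pow₀ hre))
  have hfac : ‖2 * (τ : ℂ) * Complex.I - l.im‖ ≤ 2 * τ + D := by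
    refine (norm_sub_le _ _).trans ?_
    rw [norm_mul, norm_mul, Complex.norm_I, Complex.norm_real, Complex.norm_real,
      Real.norm_of_nonneg hτ0.le, Real.norm_eq_abs]
    norm_num
    exact himD
  rw [e]
  calc _ ≤ |l.im| * 1 + |l.im| * (2 * τ + D) * 1 := by
        refine (norm_add_le _ _).trans (add_le_add ?_ ?_)
        · rw [norm_smul, Complex.norm_real, Real.norm_eq_abs]
          gcongr
        · rw [norm_smul, norm_mul, Complex.norm_real, Real.norm_eq_abs, h1]
          gcongr
    _ = |l.im| * (1 + (2 * τ + D)) := by ring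
    _ ≤ D / τ ^ 2 * ((D + 3) * τ) := by
        gcongr
        nlinarith
    _ = _ := by
        field_simp

end WaveDisk

theorem mainTheorem5 :
    (∃ lam : ℕ → ℂ, WaveDisk.IsRootSequence lam) ∧
    ∀ lam : ℕ → ℂ, WaveDisk.IsRootSequence lam →
      ∀ (z : ℕ → ℂ) (om : ℕ → ℝ), (∀ k, z k = Complex.I * lam k) → (∀ k, om k = (z k).im) →
        Tendsto om atTop atTop ∧
        (∀ᶠ k in atTop, WaveDisk.IsEigenvalue (z k) ∧
          ∃ u : WaveDisk.A.domain, WaveDisk.IsEigenvector (z k) u ∧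
            WaveDisk.IsRadial (u : WaveDisk.H)
              (fun r => WaveDisk.besselJ 0 (lam k * (r : ℂ)))) ∧
        (∀ u : ℕ → WaveDisk.A.domain,
          (∀ᶠ k in atTop, WaveDisk.IsEigenvector (z k) (u k) ∧ ‖(u k : WaveDisk.H)‖ = 1) →
          (fun k => WaveDisk.pencil (Complex.I * (om k : ℂ)) (u k))
            =O[atTop] (fun k => (om k)⁻¹)) ∧
        (∃ c : ℝ, 0 < c ∧ ∀ᶠ k in atTop, ∀ R : WaveDisk.H →L[ℂ] WaveDisk.H,
          WaveDisk.IsPencilInverse (Complex.I * (om k : ℂ)) R → c * om k ≤ ‖R‖) := by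
  refine ⟨WaveDisk.exists_isRootSequence, fun lam hlam z om hz hom => ?_⟩
  obtain ⟨D, hD, hbd⟩ := hlam.eventually_bounds
  have hre : ∀ k, om k = (lam k).re := fun k => by
    rw [hom, hz, Complex.I_mul_im]
  refine ⟨?_, ?_, fun u hu => ?_, ?_⟩
  · refine tendsto_atTop_mono' atTop ?_ tendsto_natCast_atTop_atTop
    filter_upwards [hbd] with k hk
    rw [hre]
    exact hk.2.1
  · filter_upwards [hlam.1] with k hk
    obtain ⟨u, hu, hrad⟩ := WaveDisk.exists_radial_eigenvector hk
    rw [hz]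
    exact ⟨⟨u, hu⟩, u, hu, hrad⟩
  · refine IsBigO.of_bound (D * (D + 3)) ?_
    filter_upwards [hbd, hu] with k hk huk
    have hz' := huk.1.2
    rw [hz] at hz'
    rw [hre, Real.norm_of_nonneg (inv_nonneg.2 (by linarith [hk.1]))]
    exact WaveDisk.norm_pencil_re_le hz' huk.2 hk.1 hk.2.2
  · refine ⟨(D * (D + 3))⁻¹, by positivity, ?_⟩
    filter_upwards [hbd, hlam.1] with k hk hroot R hR
    obtain ⟨v, ⟨hv0, hv⟩, -⟩ := WaveDisk.exists_radial_eigenvector hroot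
    have hvn : 0 < ‖(v : WaveDisk.H)‖ := norm_pos_iff.2 fun h => hv0 (Subtype.ext h)
    -- test the inverse on the normalized eigenvector
    set u : WaveDisk.A.domain := ((‖(v : WaveDisk.H)‖⁻¹ : ℝ) : ℂ) • v with hu
    have hu1 : ‖(u : WaveDisk.H)‖ = 1 := by
      rw [hu, Submodule.coe_smul, norm_smul, Complex.norm_real, norm_inv, norm_norm,
        inv_mul_cancel₀ hvn.ne']
    have hu0 : WaveDisk.pencil (Complex.I * lam k) u = 0 := by
      rw [hu, map_smul, hv, smul_zero]
    have hq := WaveDisk.norm_pencil_re_le hu0 hu1 hk.1 hk.2.2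
    have hRu := hR.1 u
    rw [hre] at hRu ⊢
    have hpos : 0 < (lam k).re := by linarith [hk.1]
    have h1 : 1 ≤ ‖R‖ * (D * (D + 3) * ((lam k).re)⁻¹) := by
      rw [← hu1, ← hRu]
      exact (R.le_opNorm _).trans (mul_le_mul_of_nonneg_left hq (norm_nonneg R))
    have h2 : ‖R‖ * (D * (D + 3) * ((lam k).re)⁻¹) = ‖R‖ / ((D * (D + 3))⁻¹ * (lam k).re) := by
      field_simp
    rwa [h2, one_le_div (by positivity)] at h1
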